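/- Let $m\ge 1$ and $n\ge 0$ be integers and $M=m-2n$. Let $\mathcal P=\mathbb R[x_1,\dots,x_m]\otimes\Lambda_{2n}$ be the algebra of super polynomials on $\mathbb R^{m|2n}$, where $\Lambda_{2n}$ is the real Grassmann algebra generated by $\theta_1,\dots,\theta_{2n}$, and write $X=(x_1,\dots,x_m,\theta_1,\dots,\theta_{2n})$, with $[i]=0$ for $i\le m$ and $[i]=1$ for $i>m$. Put $$R^2=\sum_{i=1}^m x_i^2-\sum_{j=1}^n\theta_{2j-1}\theta_{2j},\qquad \nabla^2=\sum_{i=1}^m\partial_{x_i}^2-4\sum_{j=1}^n\partial_{\theta_{2j-1}}\partial_{\theta_{2j}},\qquad \mathbb E=\sum_{i=1}^{m+2n}X_i\partial_{X_i},$$ and let $\mathcal H_k=\{P\in\mathcal P:\ \mathbb E P=kP,\ \nabla^2P=0\}$ be the space of spherical harmonics of degree $k$. Let $\mathfrak{osp}(m|2n)$ act on $\mathcal P$ as the real span of the operators $L_{ij}=X_i\partial_{X^j}-(-1)^{[i][j]}X_j\partial_{X^i}$, where $\partial_{X^i}=\partial_{x_i}$ for $i\le m$, and $\partial_{X^{m+2j-1}}=2\partial_{\theta_{2j}}$,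 $\partial_{X^{m+2j}}=-2\partial_{\theta_{2j-1}}$ for $1\le j\le n$. A submodule is a linear subspace stable under this action; a module is completely reducible if it is a direct sum of irreducible submodules. Suppose $M\in-2\mathbb N=\{0,-2,-4,\dots\}$ and let $k$ be an integer with $2-\frac M2\le k\le 2-M$. Then $\mathcal H_k$ is an $\mathfrak{osp}(m|2n)$-module which is not completely reducible. More precisely, $R^{2k+M-2}\mathcal H_{2-M-k}=(R^2)^{k+\frac M2-1}\mathcal H_{2-M-k}$ is an irreducible $\mathfrak{osp}(m|2n)$-submodule of $\mathcal H_k$, and there is no $\mathfrak{osp}(m|2n)$-submodule $\mathcal H_k'$ with $\mathcal H_k=R^{2k+M-2}\mathcal H_{2-M-k}\oplus\mathcal H_k'$. -/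

import Mathlib

open scoped TensorProduct

noncomputable section

namespace OspHarmonic

/-- Super polynomials on `ℝ^{m|2n}`: the algebra `ℝ[x₁,…,x_m] ⊗ Λ_{2n}`. The bosonic variables are
even, so the ordinary (unsigned) tensor product of algebras is meant. The odd generators
`x̀_{2j-1}`, `x̀_{2j}` are indexed by `(j, 0)` and `(j, 1)`. -/
abbrev SPoly (m n : ℕ) : Type :=
  MvPolynomial (Fin m) ℝ ⊗[ℝ] ExteriorAlgebra ℝ (Fin n × Fin 2 → ℝ)

/-- Indices of the coordinates `X₁,…,X_{m+2n}`: bosonic ones on the left, fermionic on the right. -/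
abbrev Idx (m n : ℕ) : Type := Fin m ⊕ (Fin n × Fin 2)

/-- The superdimension `M = m - 2n`. -/
def superdim (m n : ℕ) : ℤ := (m : ℤ) - 2 * (n : ℤ)

/-- The coordinate functions `X_i`. -/
def X {m n : ℕ} : Idx m n → SPoly m n
  | Sum.inl i => MvPolynomial.X i ⊗ₜ[ℝ] 1
  | Sum.inr a => 1 ⊗ₜ[ℝ] ExteriorAlgebra.ι ℝ (Pi.single a 1)

/-- The partial derivatives `∂_{X_i}`: the usual derivative for a bosonic variable, and the (left)
Grassmann derivative, i.e. contraction with the dual basis vector, for a fermionic variable. -/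
def partialX {m n : ℕ} : Idx m n → Module.End ℝ (SPoly m n)
  | Sum.inl i => LinearMap.rTensor _ (MvPolynomial.pderiv (R := ℝ) i).toLinearMap
  | Sum.inr a => LinearMap.lTensor _
      (CliffordAlgebra.contractLeft (Q := (0 : QuadraticForm ℝ (Fin n × Fin 2 → ℝ)))
        (LinearMap.proj a))

/-- The derivatives `∂_{X^i}` with respect to `X^j = ∑ᵢ Xᵢ gⁱʲ`, where `g` is the orthosymplectic
metric: the identity on the bosonic block and blocks `½ (0 -1; 1 0)` on the fermionic one. Thus
`X^{(j,0)} = ½ X_{(j,1)}` and `X^{(j,1)} = -½ X_{(j,0)}`. -/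
def partialUp {m n : ℕ} : Idx m n → Module.End ℝ (SPoly m n)
  | Sum.inl i => partialX (Sum.inl i)
  | Sum.inr (j, k) =>
      if k = 0 then (2 : ℝ) • partialX (Sum.inr (j, 1)) else (-2 : ℝ) • partialX (Sum.inr (j, 0))

/-- The norm squared `R² = ∑ xᵢ² - ∑ x̀_{2j-1} x̀_{2j}`. -/
def Rsq (m n : ℕ) : SPoly m n :=
  ∑ i : Fin m, X (Sum.inl i) ^ 2 - ∑ j : Fin n, X (Sum.inr (j, 0)) * X (Sum.inr (j, 1))

/-- The super Laplace operator `∇² = ∑ ∂_{xᵢ}² - 4 ∑ ∂_{x̀_{2j-1}} ∂_{x̀_{2j}}`. -/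
def laplacian (m n : ℕ) : Module.End ℝ (SPoly m n) :=
  ∑ i : Fin m, partialX (Sum.inl i) ^ 2
    - (4 : ℝ) • ∑ j : Fin n, partialX (Sum.inr (j, 0)) * partialX (Sum.inr (j, 1))

/-- The super Euler operator `𝔼 = ∑ Xᵢ ∂_{Xᵢ}`. -/
def euler (m n : ℕ) : Module.End ℝ (SPoly m n) :=
  ∑ i : Idx m n, LinearMap.mulLeft ℝ (X i) * partialX i

/-- Super polynomials of degree `k`: the solutions of `𝔼 P = k P`. -/
def polyDeg (m n k : ℕ) : Submodule ℝ (SPoly m n) :=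
  Module.End.eigenspace (euler m n) (k : ℝ)

/-- Spherical harmonics of degree `k`: `ℋ_k = 𝒫_k ∩ ker ∇²`. -/
def harmonics (m n k : ℕ) : Submodule ℝ (SPoly m n) :=
  polyDeg m n k ⊓ LinearMap.ker (laplacian m n)

/-- The subspace `R^{2s} ℋ_j`. -/
def RpowHarmonics (m n s j : ℕ) : Submodule ℝ (SPoly m n) :=
  (harmonics m n j).map (LinearMap.mulLeft ℝ (Rsq m n ^ s))

/-- The sign `(-1)^{[i][j]}`. -/
def superSign {m n : ℕ} : Idx m n → Idx m n → ℝ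
  | Sum.inr _, Sum.inr _ => -1
  | _, _ => 1

/-- The differential operators `L_{ij} = X_i ∂_{X^j} - (-1)^{[i][j]} X_j ∂_{X^i}`. -/
def Lop {m n : ℕ} (i j : Idx m n) : Module.End ℝ (SPoly m n) :=
  LinearMap.mulLeft ℝ (X i) * partialUp j
    - superSign i j • (LinearMap.mulLeft ℝ (X j) * partialUp i)

/-- The orthosymplectic Lie superalgebra `𝔬𝔰𝔭(m|2n)`, realized by differential operators on super
polynomials: the span of the `L_{ij}`. -/
def osp (m n : ℕ) : Submodule ℝ (Module.End ℝ (SPoly m n)) :=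
  Submodule.span ℝ (Set.range fun p : Idx m n × Idx m n => Lop p.1 p.2)

/-- `V` is an `𝔬𝔰𝔭(m|2n)`-module, i.e. a subspace stable under the action. -/
def IsOspModule {m n : ℕ} (V : Submodule ℝ (SPoly m n)) : Prop :=
  ∀ A ∈ osp m n, ∀ v ∈ V, A v ∈ V

/-- `V` is an irreducible `𝔬𝔰𝔭(m|2n)`-module: nonzero, with no submodules except `0` and `V`. -/
def IsOspIrreducible {m n : ℕ} (V : Submodule ℝ (SPoly m n)) : Prop :=
  IsOspModule V ∧ V ≠ ⊥ ∧ ∀ U ≤ V, IsOspModule U → U = ⊥ ∨ U = V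

/-- `V` is completely reducible: a direct sum of irreducible `𝔬𝔰𝔭(m|2n)`-modules. -/
def IsOspCompletelyReducible {m n : ℕ} (V : Submodule ℝ (SPoly m n)) : Prop :=
  ∃ S : Set (Submodule ℝ (SPoly m n)),
    (∀ U ∈ S, IsOspIrreducible U) ∧ sSupIndep S ∧ sSup S = V

/-- `W` has an invariant complement in `V`: there is a module `U` with `V = W ⊕ U`. -/
def HasOspComplement {m n : ℕ} (W V : Submodule ℝ (SPoly m n)) : Prop :=
  ∃ U : Submodule ℝ (SPoly m n), IsOspModule U ∧ Disjoint W U ∧ W ⊔ U = V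

end OspHarmonic

end

noncomputable section

namespace OspHarmonic

variable {m n : ℕ}

/-! Write W for the submodule R^{2k+M-2} ℋ_{2-M-k}. The operators L_ij commute with R², ∇² and 𝔼,
and [∇², R²] = 4𝔼 + 2M. Hence ∇² sends R^{2s} h, for h harmonic of degree j, to 2s(2j + 2s - 2 + M)
R^{2s-2} h. The factor vanishes for j = 2-M-k and s = k + M/2 - 1, which puts W inside ℋ_k.

The main tool is a symmetric bilinear form, nondegenerate in each degree, for which X_i is
transposed to a nonzero multiple of ∂_{X_i}. Then R² is transposed to ∇² (`form_Rsq_mul`) and each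
L_ij to a multiple of another one (`form_Lop`), so orthogonal complements of submodules are
submodules. The second tool is `le_rsqIdeal_of_isOspModule`: a submodule contained in the ideal (R²)
+ (θ) is already contained in (R²). By duality, the harmonics free of θ generate ℋ_k
(`harmonics_le_of_pureDeg_le`).

No complement: let U be one. A polynomial in the Casimir operator of 𝔰𝔬(m) kills all polynomials of
degree at most j, hence also W, because it commutes with R². On a θ-free harmonic of degree k > j it
is a nonzero scalar. Applied to t = w + u, it shows that every θ-free harmonic t lies in U. These
generate, so U = ℋ_k and W = 0, which is false.

Irreducibility: since 2j + M ≤ 0, every polynomial of degree j is a harmonic plus a multiple of R²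
(`exists_harmonic_add_Rsq_mul`). Consequently a nonzero submodule of ℋ_j contains a nonzero θ-free
element (`exists_pureDeg_mem`), and rotations turn this into θ_{(0,0)} ⋯ θ_{(j-1,0)} up to order and
scalar (`oddTop_mem`). A proper nonzero submodule and its orthogonal complement in ℋ_j would both
contain this vector, whose pairing with itself is nonzero. Multiplication by a power of R²
transports the result to W.

Complete reducibility would make ℋ_k semisimple over the associative algebra generated by the
action, so W would have a complement. -/

/-- Right partner under the orthosymplectic pairing. -/
def bar : Idx m n → Idx m n
  | Sum.inl i => Sum.inl i
  | Sum.inr (j, k) => Sum.inr (j, 1 - k)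

/-- The sign `1` on bosonic and `-1` on fermionic indices. -/
def eps : Idx m n → ℝ
  | Sum.inl _ => 1
  | Sum.inr _ => -1

/-! ### Supercommutation of coordinates and derivatives -/

theorem superSign_mul_self (i j : Idx m n) : superSign i j * superSign i j = 1 := by
  rcases i with i | i <;> rcases j with j | j <;> simp [superSign]

theorem superSign_comm (i j : Idx m n) : superSign i j = superSign j i := by
  rcases i with i | i <;> rcases j with j | j <;> simp [superSign]

theorem neg_one_smul' (p : SPoly m n) : (-1 : ℝ) • p = -p := neg_one_smul ℝ p

theorem mul_neg' (p q : SPoly m n) : p * -q = -(p * q) := mul_neg p q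

/-- The algebra is generated from 1 by left multiplication with coordinates, so identities between
operators can be checked by commuting them past a single X_i. -/
theorem spoly_induction {C : SPoly m n → Prop} (one : C 1)
    (add : ∀ p q, C p → C q → C (p + q)) (smul : ∀ (r : ℝ) p, C p → C (r • p))
    (X_mul : ∀ i p, C p → C (X i * p)) (p : SPoly m n) : C p := by
  have zero : C 0 := by simpa using smul 0 _ one
  have sum : ∀ (s : Finset (Fin n × Fin 2)) (f : Fin n × Fin 2 → SPoly m n),
      (∀ a ∈ s, C (f a)) → C (∑ a ∈ s, f a) := by
    intro s f
    induction s using Finset.induction_on with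
    | empty => intro _; simpa using zero
    | insert a s ha ih =>
      intro h
      rw [Finset.sum_insert ha]
      exact add _ _ (h _ (by simp)) (ih fun b hb => h b (by simp [hb]))
  have hf : ∀ ω : ExteriorAlgebra ℝ (Fin n × Fin 2 → ℝ),
      C ((1 : MvPolynomial (Fin m) ℝ) ⊗ₜ ω) := by
    intro ω
    induction ω using CliffordAlgebra.left_induction with
    | algebraMap r =>
      rw [Algebra.algebraMap_eq_smul_one, TensorProduct.tmul_smul]
      exact smul _ _ one
    | add x y hx hy => rw [TensorProduct.tmul_add]; exact add _ _ hx hy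
    | ι_mul x v hx =>
      have hv : v = ∑ a, v a • Pi.single a (1 : ℝ) := by
        funext b; simp [Finset.sum_apply, Pi.single_apply]
      have : (1 : MvPolynomial (Fin m) ℝ) ⊗ₜ[ℝ] (CliffordAlgebra.ι 0 v * x) =
          ∑ a, v a • ((X (Sum.inr a) : SPoly m n) * ((1 : MvPolynomial (Fin m) ℝ) ⊗ₜ[ℝ] x)) := by
        conv_lhs => rw [hv]
        rw [map_sum, Finset.sum_mul, TensorProduct.tmul_sum]
        refine Finset.sum_congr rfl fun a _ => ?_
        simp only [X, Algebra.TensorProduct.tmul_mul_tmul, one_mul, map_smul,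
          smul_mul_assoc, TensorProduct.tmul_smul]
      rw [this]
      exact sum _ _ fun a _ => smul _ _ (X_mul _ _ hx)
  induction p using TensorProduct.induction_on with
  | zero => exact zero
  | add x y hx hy => exact add _ _ hx hy
  | tmul p ω =>
    induction p using MvPolynomial.induction_on with
    | C r =>
      rw [← mul_one (MvPolynomial.C r), MvPolynomial.C_mul', ← TensorProduct.smul_tmul']
      exact smul _ _ (hf ω)
    | add p q hp hq => rw [TensorProduct.add_tmul]; exact add _ _ hp hq
    | mul_X p i hp =>
      have : (p * MvPolynomial.X i) ⊗ₜ[ℝ] ω = X (Sum.inl i) * (p ⊗ₜ[ℝ] ω) := by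
        simp [X, mul_comm]
      rw [this]
      exact X_mul _ _ hp

theorem X_mul_X (i j : Idx m n) :
    (X i * X j : SPoly m n) = superSign i j • (X j * X i) := by
  rcases i with i | i <;> rcases j with j | j <;> simp [superSign, X, mul_comm]
  have := ExteriorAlgebra.ι_add_mul_swap (R := ℝ) (Pi.single i 1 : Fin n × Fin 2 → ℝ)
    (Pi.single j 1)
  rw [neg_one_smul', ← TensorProduct.tmul_neg, eq_neg_of_add_eq_zero_left this]

theorem X_mul_X_mul (i j : Idx m n) (p : SPoly m n) :
    X i * (X j * p) = superSign i j • (X j * (X i * p)) := by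
  rw [← mul_assoc, X_mul_X, smul_mul_assoc, mul_assoc]

theorem X_inl_mul (i : Fin m) (p q : SPoly m n) :
    p * (X (Sum.inl i) * q) = X (Sum.inl i) * (p * q) := by
  have : ∀ p : SPoly m n, p * X (Sum.inl i) = X (Sum.inl i) * p := by
    intro p
    induction p using TensorProduct.induction_on with
    | zero => simp
    | add x y hx hy => rw [add_mul, mul_add, hx, hy]
    | tmul p ω => simp [X, mul_comm]
  rw [← mul_assoc, this, mul_assoc]

@[simp] theorem partialX_one (i : Idx m n) : partialX i (1 : SPoly m n) = 0 := by
  rcases i with i | i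
  · simp [partialX, Algebra.TensorProduct.one_def]
  · simp only [partialX, Algebra.TensorProduct.one_def, LinearMap.lTensor_tmul]
    erw [CliffordAlgebra.contractLeft_one]
    simp

theorem partialX_X_mul (i j : Idx m n) (p : SPoly m n) :
    partialX i (X j * p) = (if i = j then p else 0) + superSign i j • (X j * partialX i p) := by
  induction p using TensorProduct.induction_on with
  | zero => simp
  | add x y hx hy =>
    rw [mul_add, map_add, hx, hy, map_add, mul_add, smul_add]
    split_ifs <;> abel
  | tmul p ω =>
    rcases i with i | i <;> rcases j with j | j
    · by_cases h : i = j
      · subst h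
        simp [partialX, X, superSign, TensorProduct.add_tmul, add_comm, Derivation.leibniz]
      · have h' : j ≠ i := Ne.symm h
        simp [partialX, X, superSign, h, Derivation.leibniz, MvPolynomial.pderiv_X_of_ne h']
    · simp [partialX, X, superSign]
    · simp [partialX, X, superSign]
    · have key : CliffordAlgebra.contractLeft (Q := (0 : QuadraticForm ℝ (Fin n × Fin 2 → ℝ)))
          (LinearMap.proj i) (ExteriorAlgebra.ι ℝ (Pi.single j 1) * ω) =
          (if i = j then ω else 0) - ExteriorAlgebra.ι ℝ (Pi.single j 1) *
            CliffordAlgebra.contractLeft (Q := (0 : QuadraticForm ℝ (Fin n × Fin 2 → ℝ)))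
          (LinearMap.proj i) ω := by
        refine (CliffordAlgebra.contractLeft_ι_mul _ _ _).trans ?_
        congr 1
        by_cases h : i = j <;> simp [h]
      simp only [partialX, X, superSign, Algebra.TensorProduct.tmul_mul_tmul, one_mul,
        LinearMap.lTensor_tmul, key, TensorProduct.tmul_sub, Sum.inr.injEq]
      split_ifs <;> simp [sub_eq_add_neg, neg_one_smul']

theorem partialX_comm (i j : Idx m n) (p : SPoly m n) :
    partialX i (partialX j p) = superSign i j • partialX j (partialX i p) := by
  induction p using spoly_induction with
  | one => simp
  | add p q hp hq => simp only [map_add, hp, hq, smul_add]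
  | smul r p hp => simp only [map_smul, hp]; rw [smul_comm]
  | X_mul k p hp =>
    simp only [partialX_X_mul, map_add, map_smul, hp, smul_add, mul_smul_comm, smul_smul]
    have h1 : ∀ (a b : Idx m n), partialX a (if b = k then p else 0) =
        if b = k then partialX a p else 0 := by intro a b; split_ifs <;> simp
    have h2 := superSign_mul_self i j
    rw [h1 i j, h1 j i]
    by_cases hi : i = k <;> by_cases hj : j = k
    · rw [hi, hj]
      rcases k with k | k <;> simp [superSign]
    · rw [← hi]
      simp only [hi, if_true, if_neg hj, smul_zero, zero_add]
      rw [superSign_comm j k, ← hi]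
    · subst hj
      simp only [if_neg hi, if_true, zero_add, h2, one_smul, ← mul_assoc, smul_zero, mul_one,
        one_mul]
    · simp only [hi, hj, if_false, smul_zero, zero_add]
      congr 1
      ring

/-! ### Commutators of R², ∇², 𝔼 and the L_ij -/

/-- The coefficient in `∂_{X^i} = metricCoeff i • ∂_{X_{bar i}}`. -/
def metricCoeff : Idx m n → ℝ
  | Sum.inl _ => 1
  | Sum.inr (_, k) => if k = 0 then 2 else -2

@[simp] theorem bar_bar (i : Idx m n) : bar (bar i) = i := by
  rcases i with i | ⟨j, k⟩ <;> simp [bar]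

theorem partialUp_eq (i : Idx m n) : partialUp i = metricCoeff i • partialX (bar i) := by
  rcases i with i | ⟨j, k⟩
  · simp [partialUp, metricCoeff, bar]
  · fin_cases k <;> simp [partialUp, metricCoeff, bar]

@[simp] theorem superSign_bar_left (i j : Idx m n) : superSign (bar i) j = superSign i j := by
  rcases i with i | i <;> rcases j with j | j <;> simp [bar, superSign]

@[simp] theorem superSign_bar_right (i j : Idx m n) : superSign i (bar j) = superSign i j := by
  rw [superSign_comm, superSign_bar_left, superSign_comm]

theorem partialUp_comm (i j : Idx m n) (p : SPoly m n) :
    partialUp i (partialUp j p) = superSign i j • partialUp j (partialUp i p) := by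
  simp only [partialUp_eq, LinearMap.smul_apply, map_smul]
  rw [partialX_comm (bar i)]
  simp only [superSign_bar_left, superSign_bar_right, smul_smul]
  congr 1
  ring

theorem Rsq_mul (p : SPoly m n) : Rsq m n * p = ∑ i : Fin m, X (Sum.inl i) * (X (Sum.inl i) * p)
    - ∑ j : Fin n, X (Sum.inr (j, 0)) * (X (Sum.inr (j, 1)) * p) := by
  simp only [Rsq, sub_mul, Finset.sum_mul, pow_two, mul_assoc]

theorem laplacian_apply (p : SPoly m n) : laplacian m n p =
    ∑ i : Fin m, partialX (Sum.inl i) (partialX (Sum.inl i) p)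
    - (4 : ℝ) • ∑ j : Fin n, partialX (Sum.inr (j, 0)) (partialX (Sum.inr (j, 1)) p) := by
  simp [laplacian, LinearMap.sum_apply, pow_two]

theorem euler_apply (p : SPoly m n) : euler m n p = ∑ i : Idx m n, X i * partialX i p := by
  simp [euler, LinearMap.sum_apply]

theorem Lop_apply (i j : Idx m n) (p : SPoly m n) :
    Lop i j p = X i * partialUp j p - superSign i j • (X j * partialUp i p) := by
  simp [Lop]

theorem X_mul_Rsq_mul (i : Idx m n) (p : SPoly m n) :
    X i * (Rsq m n * p) = Rsq m n * (X i * p) := by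
  simp only [Rsq_mul, mul_sub, Finset.mul_sum]
  congr 1
  · refine Finset.sum_congr rfl fun l _ => ?_
    rw [X_inl_mul, X_inl_mul]
  · refine Finset.sum_congr rfl fun l _ => ?_
    rw [X_mul_X_mul i, X_mul_X_mul i, mul_smul_comm, smul_smul]
    rcases i with i | i <;> simp [superSign]

/-- The coefficients 2 and -2 in the raised odd derivatives are what make this hold uniformly in i.
It is dual to `laplacian_X_mul`; the two together give the invariance of R² and ∇². -/
theorem partialUp_Rsq_mul (i : Idx m n) (p : SPoly m n) :
    partialUp i (Rsq m n * p) = Rsq m n * partialUp i p + (2 : ℝ) • (X i * p) := by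
  rw [partialUp_eq]
  simp only [LinearMap.smul_apply, Rsq_mul, map_sub, map_sum, partialX_X_mul]
  rcases i with i | ⟨j, k⟩
  · simp [metricCoeff, bar, superSign, mul_add, Finset.sum_add_distrib]
    simp [two_smul]
    abel
  · fin_cases k <;>
    · simp [metricCoeff, bar, superSign, mul_add, Finset.sum_add_distrib, neg_one_smul']
      simp only [mul_smul_comm, mul_neg', smul_neg, Finset.sum_neg_distrib, ← Finset.smul_sum]
      module

theorem laplacian_X_mul (i : Idx m n) (p : SPoly m n) :
    laplacian m n (X i * p) = X i * laplacian m n p + (2 : ℝ) • partialUp i p := by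
  rw [partialUp_eq]
  have h : ∀ (c : Prop) [Decidable c] (l : Idx m n), partialX l (if c then p else 0) =
      if c then partialX l p else 0 := by intro c _ l; split_ifs <;> simp
  simp only [laplacian_apply, partialX_X_mul, map_add, map_smul, h, LinearMap.smul_apply]
  rcases i with i | ⟨j, k⟩
  · simp [metricCoeff, bar, superSign, mul_sub, Finset.sum_add_distrib, Finset.mul_sum,
      two_smul]
    simp only [mul_smul_comm, Finset.mul_sum]
    module
  · fin_cases k <;>
    · simp [metricCoeff, bar, superSign, mul_sub, Finset.sum_add_distrib, Finset.mul_sum,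
        neg_one_smul']
      simp only [mul_smul_comm, Finset.mul_sum]
      module

theorem laplacian_partialX (i : Idx m n) (p : SPoly m n) :
    laplacian m n (partialX i p) = partialX i (laplacian m n p) := by
  simp only [laplacian_apply, map_sub, map_sum, map_smul]
  congr 1
  · refine Finset.sum_congr rfl fun l _ => ?_
    rw [partialX_comm i, partialX_comm i, map_smul, smul_smul, superSign_mul_self, one_smul]
  · congr 1
    refine Finset.sum_congr rfl fun l _ => ?_
    rw [partialX_comm i, partialX_comm i (Sum.inr (l, 1)), map_smul, smul_smul]
    rcases i with i | i <;> simp [superSign]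

theorem laplacian_partialUp (i : Idx m n) (p : SPoly m n) :
    laplacian m n (partialUp i p) = partialUp i (laplacian m n p) := by
  simp [partialUp_eq, laplacian_partialX]

theorem euler_X_mul (i : Idx m n) (p : SPoly m n) :
    euler m n (X i * p) = X i * euler m n p + X i * p := by
  simp only [euler_apply, partialX_X_mul, mul_add, Finset.sum_add_distrib, Finset.mul_sum]
  rw [add_comm]
  congr 1
  · refine Finset.sum_congr rfl fun l _ => ?_
    rw [mul_smul_comm, X_mul_X_mul l i, smul_smul, superSign_mul_self, one_smul]
  · simp [mul_ite]

theorem euler_partialX (i : Idx m n) (p : SPoly m n) :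
    euler m n (partialX i p) = partialX i (euler m n p) - partialX i p := by
  rw [eq_sub_iff_add_eq]
  simp only [euler_apply, partialX_X_mul, map_sum, Finset.sum_add_distrib]
  rw [add_comm]
  congr 1
  · simp
  · refine Finset.sum_congr rfl fun l _ => ?_
    rw [partialX_comm i l, mul_smul_comm, smul_smul, superSign_mul_self, one_smul]

theorem euler_partialUp (i : Idx m n) (p : SPoly m n) :
    euler m n (partialUp i p) = partialUp i (euler m n p) - partialUp i p := by
  simp [partialUp_eq, euler_partialX, smul_sub]

/-- The two correction terms 2 X_i X_j p and 2 X_j X_i p cancel by supercommutativity. -/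
theorem Lop_Rsq_mul (i j : Idx m n) (p : SPoly m n) :
    Lop i j (Rsq m n * p) = Rsq m n * Lop i j p := by
  simp only [Lop_apply, partialUp_Rsq_mul, mul_add, mul_sub, X_mul_Rsq_mul, mul_smul_comm,
    smul_add]
  rw [X_mul_X_mul i j]
  simp only [smul_smul, mul_comm (2 : ℝ)]
  abel

theorem laplacian_Lop (i j : Idx m n) (p : SPoly m n) :
    laplacian m n (Lop i j p) = Lop i j (laplacian m n p) := by
  simp only [Lop_apply, map_sub, map_smul, laplacian_X_mul, laplacian_partialUp, smul_add]
  rw [partialUp_comm i j]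
  simp only [smul_smul, mul_comm (2 : ℝ)]
  abel

theorem euler_Lop (i j : Idx m n) (p : SPoly m n) :
    euler m n (Lop i j p) = Lop i j (euler m n p) := by
  simp only [Lop_apply, map_sub, map_smul, euler_X_mul, euler_partialUp, mul_sub, smul_add,
    smul_sub]
  abel

/-- The 𝔰𝔩₂ relation. Each bosonic variable contributes 2 to the constant and each pair of odd
variables -4, which adds up to 2M. -/
theorem laplacian_Rsq_mul (p : SPoly m n) : laplacian m n (Rsq m n * p) =
    Rsq m n * laplacian m n p + (4 : ℝ) • euler m n p + (2 * (superdim m n : ℝ)) • p := by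
  have h1 : ∀ i : Fin m, laplacian m n (X (Sum.inl i) * (X (Sum.inl i) * p)) =
      X (Sum.inl i) * (X (Sum.inl i) * laplacian m n p) +
      ((4 : ℝ) • (X (Sum.inl i) * partialX (Sum.inl i) p) + (2 : ℝ) • p) := by
    intro i
    simp only [laplacian_X_mul, partialUp_eq, metricCoeff, bar, one_smul, partialX_X_mul, if_true,
      superSign, mul_add, mul_smul_comm]
    module
  have h2 : ∀ j : Fin n, laplacian m n (X (Sum.inr (j, 0)) * (X (Sum.inr (j, 1)) * p)) =
      X (Sum.inr (j, 0)) * (X (Sum.inr (j, 1)) * laplacian m n p) -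
      ((4 : ℝ) • (X (Sum.inr (j, 0)) * partialX (Sum.inr (j, 0)) p) +
       (4 : ℝ) • (X (Sum.inr (j, 1)) * partialX (Sum.inr (j, 1)) p) - (4 : ℝ) • p) := by
    intro j
    simp only [laplacian_X_mul, partialUp_eq, metricCoeff, bar, partialX_X_mul,
      superSign, mul_add, mul_smul_comm, LinearMap.smul_apply]
    simp
    module
  rw [Rsq_mul, Rsq_mul, map_sub, map_sum, map_sum, Finset.sum_congr rfl fun i _ => h1 i,
    Finset.sum_congr rfl fun i _ => h2 i, euler_apply, Fintype.sum_sum_type,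
    Fintype.sum_prod_type]
  simp only [Finset.sum_add_distrib, Finset.sum_sub_distrib, Fin.sum_univ_two, ← Finset.smul_sum,
    Finset.sum_const, Finset.card_univ, Fintype.card_fin, superdim]
  push_cast
  module

theorem isOspModule_iff {V : Submodule ℝ (SPoly m n)} :
    IsOspModule V ↔ ∀ i j, ∀ v ∈ V, Lop i j v ∈ V := by
  constructor
  · intro h i j v hv
    exact h _ (Submodule.subset_span ⟨(i, j), rfl⟩) v hv
  · intro h A hA
    induction hA using Submodule.span_induction with
    | mem A hA => obtain ⟨⟨i, j⟩, rfl⟩ := hA; exact h i j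
    | zero => intro v _; simp
    | add A B _ _ hA hB => intro v hv; exact V.add_mem (hA v hv) (hB v hv)
    | smul r A _ hA => intro v hv; exact V.smul_mem r (hA v hv)

theorem isOspModule_harmonics (k : ℕ) : IsOspModule (harmonics m n k) := by
  rw [isOspModule_iff]
  rintro i j v ⟨h1, h2⟩
  refine ⟨?_, ?_⟩
  · rw [SetLike.mem_coe, polyDeg, Module.End.mem_eigenspace_iff] at h1 ⊢
    rw [euler_Lop, h1, map_smul]
  · rw [SetLike.mem_coe, LinearMap.mem_ker] at h2 ⊢
    rw [laplacian_Lop, h2, map_zero]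

/-! ### The bilinear form and its adjunctions -/

/-- The Fischer form on polynomials: monomials are orthogonal, with norms `α!`. -/
def polyForm (m : ℕ) : LinearMap.BilinForm ℝ (MvPolynomial (Fin m) ℝ) :=
  (MvPolynomial.basisMonomials (Fin m) ℝ).constr ℝ fun α =>
    (∏ i, ((α i).factorial : ℝ)) • MvPolynomial.lcoeff ℝ α

theorem polyForm_monomial (α : Fin m →₀ ℕ) (q : MvPolynomial (Fin m) ℝ) :
    polyForm m (MvPolynomial.monomial α 1) q =
      (∏ i, ((α i).factorial : ℝ)) * MvPolynomial.coeff α q := by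
  have := (MvPolynomial.basisMonomials (Fin m) ℝ).constr_basis ℝ (fun α =>
    (∏ i, ((α i).factorial : ℝ)) • MvPolynomial.lcoeff ℝ α) α
  rw [MvPolynomial.coe_basisMonomials] at this
  simp [polyForm, this]

theorem polyForm_X_mul (i : Fin m) (p q : MvPolynomial (Fin m) ℝ) :
    polyForm m (MvPolynomial.X i * p) q = polyForm m p (MvPolynomial.pderiv i q) := by
  induction p using MvPolynomial.induction_on' with
  | add p q hp hq => simp only [mul_add, map_add, LinearMap.add_apply, hp, hq]
  | monomial α a =>
    have h1 : (MvPolynomial.X i * MvPolynomial.monomial α a : MvPolynomial (Fin m) ℝ) =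
        a • MvPolynomial.monomial (α + Finsupp.single i 1) 1 := by
      simp [MvPolynomial.X, MvPolynomial.monomial_mul, MvPolynomial.smul_monomial, add_comm]
    have h2 : (MvPolynomial.monomial α a : MvPolynomial (Fin m) ℝ) =
        a • MvPolynomial.monomial α 1 := by simp [MvPolynomial.smul_monomial]
    rw [h1, h2, map_smul, map_smul, LinearMap.smul_apply, LinearMap.smul_apply, polyForm_monomial,
      polyForm_monomial, MvPolynomial.coeff_pderiv]
    have h3 : (∏ l, (((α + Finsupp.single i 1 : Fin m →₀ ℕ) l).factorial : ℝ)) =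
        (α i + 1) * ∏ l, ((α l).factorial : ℝ) := by
      rw [← Finset.mul_prod_erase _ _ (Finset.mem_univ i),
        ← Finset.mul_prod_erase _ (fun l => ((α l).factorial : ℝ)) (Finset.mem_univ i)]
      rw [Finset.prod_congr rfl (g := fun l => ((α l).factorial : ℝ))]
      · simp [Nat.factorial_succ]; ring
      · intro l hl
        have : i ≠ l := (Finset.ne_of_mem_erase hl).symm
        simp [this]
    rw [h3]
    congr 1
    ring

theorem polyForm_one_X_mul (i : Fin m) (p : MvPolynomial (Fin m) ℝ) :
    polyForm m 1 (MvPolynomial.X i * p) = 0 := by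
  rw [← MvPolynomial.C_1, ← MvPolynomial.monomial_zero', polyForm_monomial]
  simp [← MvPolynomial.constantCoeff_eq]

theorem polyForm_one_one : polyForm m 1 1 = 1 := by
  conv_lhs => rw [← MvPolynomial.C_1, ← MvPolynomial.monomial_zero', polyForm_monomial]
  simp

/-- The diagonal pairing on the odd generators with entries `2, -2`. -/
def oddPairing (n : ℕ) : (Fin n × Fin 2 → ℝ) →ₗ[ℝ] Module.Dual ℝ (Fin n × Fin 2 → ℝ) :=
  ∑ a : Fin n × Fin 2, (metricCoeff (m := 0) (Sum.inr a)) •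
    (LinearMap.proj a : (Fin n × Fin 2 → ℝ) →ₗ[ℝ] ℝ).smulRight
      (LinearMap.proj a : (Fin n × Fin 2 → ℝ) →ₗ[ℝ] ℝ)

theorem oddPairing_single (a : Fin n × Fin 2) : oddPairing n (Pi.single a 1) =
    (metricCoeff (m := 0) (Sum.inr a)) • (LinearMap.proj a : (Fin n × Fin 2 → ℝ) →ₗ[ℝ] ℝ) := by
  rw [oddPairing, LinearMap.sum_apply, Finset.sum_eq_single a]
  · simp
  · intro b _ hb
    simp [hb]
  · simp

/-- Exterior forms acting by contraction. -/
def contractHom (n : ℕ) : ExteriorAlgebra ℝ (Fin n × Fin 2 → ℝ) →ₐ[ℝ]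
    Module.End ℝ (ExteriorAlgebra ℝ (Fin n × Fin 2 → ℝ)) :=
  ExteriorAlgebra.lift ℝ ⟨(CliffordAlgebra.contractLeft
    (Q := (0 : QuadraticForm ℝ (Fin n × Fin 2 → ℝ)))).comp (oddPairing n), fun v => by
      exact LinearMap.ext fun x =>
        CliffordAlgebra.contractLeft_contractLeft (oddPairing n v) x⟩

/-- The diagonal form on the exterior algebra. -/
def extForm (n : ℕ) : LinearMap.BilinForm ℝ (ExteriorAlgebra ℝ (Fin n × Fin 2 → ℝ)) :=
  ((contractHom n).toLinearMap.comp CliffordAlgebra.reverse).compr₂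
    (ExteriorAlgebra.algebraMapInv).toLinearMap

/-- Reversal moves the leftmost factor to the right, so that its contraction is the first one
applied to η. -/
theorem extForm_ι_mul (a : Fin n × Fin 2) (ω η : ExteriorAlgebra ℝ (Fin n × Fin 2 → ℝ)) :
    extForm n (ExteriorAlgebra.ι ℝ (Pi.single a 1) * ω) η =
      metricCoeff (m := 0) (Sum.inr a) * extForm n ω (CliffordAlgebra.contractLeft
        (Q := (0 : QuadraticForm ℝ (Fin n × Fin 2 → ℝ))) (LinearMap.proj a) η) := by
  have h : contractHom n (ExteriorAlgebra.ι ℝ (Pi.single a 1)) η =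
      metricCoeff (m := 0) (Sum.inr a) • (CliffordAlgebra.contractLeft
        (Q := (0 : QuadraticForm ℝ (Fin n × Fin 2 → ℝ))) (LinearMap.proj a) η) := by
    rw [contractHom, ExteriorAlgebra.lift_ι_apply]
    simp [oddPairing_single]
  have h2 : CliffordAlgebra.reverse (Q := (0 : QuadraticForm ℝ (Fin n × Fin 2 → ℝ)))
      (ExteriorAlgebra.ι ℝ (Pi.single a 1) * ω) =
      CliffordAlgebra.reverse (Q := (0 : QuadraticForm ℝ (Fin n × Fin 2 → ℝ))) ω *
        ExteriorAlgebra.ι ℝ (Pi.single a 1) := by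
    rw [CliffordAlgebra.reverse.map_mul]
    congr 1
    exact CliffordAlgebra.reverse_ι _
  simp only [extForm, LinearMap.compr₂_apply, LinearMap.comp_apply, h2, AlgHom.toLinearMap_apply,
    map_mul, Module.End.mul_apply, h, map_smul, smul_eq_mul]

theorem extForm_one_ι_mul (v : Fin n × Fin 2 → ℝ) (η : ExteriorAlgebra ℝ (Fin n × Fin 2 → ℝ)) :
    extForm n 1 (ExteriorAlgebra.ι ℝ v * η) = 0 := by
  simp only [extForm, LinearMap.compr₂_apply, LinearMap.comp_apply, AlgHom.toLinearMap_apply]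
  rw [CliffordAlgebra.reverse.map_one, map_one]
  simp [ExteriorAlgebra.algebraMapInv]

theorem extForm_one_one : extForm n 1 1 = 1 := by
  simp only [extForm, LinearMap.compr₂_apply, LinearMap.comp_apply, AlgHom.toLinearMap_apply]
  rw [CliffordAlgebra.reverse.map_one, map_one (contractHom n), Module.End.one_apply]
  exact map_one ExteriorAlgebra.algebraMapInv

/-- The bilinear form on super polynomials for which multiplication by `X_i` is transposed to
`metricCoeff i • ∂_{X_i}`. -/
def form (m n : ℕ) : LinearMap.BilinForm ℝ (SPoly m n) :=
  LinearMap.BilinForm.tmul (polyForm m) (extForm n)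

theorem form_X_mul (i : Idx m n) (p q : SPoly m n) :
    form m n (X i * p) q = metricCoeff i * form m n p (partialX i q) := by
  induction p using TensorProduct.induction_on with
  | zero => simp
  | add x y hx hy => simp only [mul_add, map_add, LinearMap.add_apply, hx, hy]
  | tmul p ω =>
    induction q using TensorProduct.induction_on with
    | zero => simp
    | add x y hx hy => simp only [mul_add, map_add, hx, hy]
    | tmul q η =>
      rcases i with i | i
      · simp [X, partialX, form, polyForm_X_mul, metricCoeff]
      · simp only [X, partialX, form, Algebra.TensorProduct.tmul_mul_tmul, one_mul,
          LinearMap.BilinForm.tensorDistrib_tmul, LinearMap.lTensor_tmul, extForm_ι_mul, metricCoeff]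
        simp
        ring_nf

theorem form_one_X_mul (i : Idx m n) (q : SPoly m n) : form m n 1 (X i * q) = 0 := by
  induction q using TensorProduct.induction_on with
  | zero => simp
  | add x y hx hy => simp only [mul_add, map_add, hx, hy, add_zero]
  | tmul q η =>
    rcases i with i | i <;>
    simp [X, form, Algebra.TensorProduct.one_def, polyForm_one_X_mul, extForm_one_ι_mul]

theorem form_one_one : form m n 1 1 = 1 := by
  simp [form, Algebra.TensorProduct.one_def, polyForm_one_one, extForm_one_one]

/-- Transposition works with the same constant in the second argument; this is what gives symmetry
of the form without evaluating it on monomials. -/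
theorem form_apply_X_mul (i : Idx m n) (p q : SPoly m n) :
    form m n p (X i * q) = metricCoeff i * form m n (partialX i p) q := by
  induction p using spoly_induction generalizing q with
  | one => simp [form_one_X_mul]
  | add x y hx hy => simp only [map_add, LinearMap.add_apply, hx, hy, mul_add]
  | smul r x hx =>
    simp only [map_smul, LinearMap.smul_apply, hx, smul_eq_mul]
    ring
  | X_mul j p hp =>
    rw [form_X_mul, partialX_X_mul, partialX_X_mul]
    simp only [map_add, map_smul, LinearMap.add_apply, LinearMap.smul_apply, hp, form_X_mul,
      smul_eq_mul]
    by_cases h : i = j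
    · subst h
      simp
    · simp [h, Ne.symm h, superSign_comm j i]
      ring

theorem form_symm (p q : SPoly m n) : form m n p q = form m n q p := by
  induction p using spoly_induction generalizing q with
  | one =>
    induction q using spoly_induction with
    | one => rfl
    | add x y hx hy => simp only [map_add, LinearMap.add_apply, hx, hy]
    | smul r x hx => simp only [map_smul, LinearMap.smul_apply, hx]
    | X_mul j p hp => simp [form_one_X_mul, form_X_mul]
  | add x y hx hy => simp only [map_add, LinearMap.add_apply, hx, hy]
  | smul r x hx => simp only [map_smul, LinearMap.smul_apply, hx]
  | X_mul j p hp => rw [form_X_mul, form_apply_X_mul, hp]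

theorem form_X_mul_eq_partialUp (i : Idx m n) (p q : SPoly m n) :
    form m n (X i * p) q = eps i * form m n p (partialUp (bar i) q) := by
  rw [form_X_mul, partialUp_eq, bar_bar, LinearMap.smul_apply, map_smul, smul_eq_mul, ← mul_assoc]
  congr 1
  rcases i with i | ⟨j, k⟩
  · simp [metricCoeff, eps, bar]
  · fin_cases k <;> simp [metricCoeff, eps, bar]

theorem eps_mul_self (i : Idx m n) : eps i * eps i = 1 := by
  rcases i with i | i <;> simp [eps]

theorem eps_bar (i : Idx m n) : eps (bar i) = eps i := by
  rcases i with i | i <;> simp [eps, bar]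

theorem form_partialUp (i : Idx m n) (p q : SPoly m n) :
    form m n (partialUp i p) q = eps i * form m n p (X (bar i) * q) := by
  rw [form_symm p, form_X_mul_eq_partialUp, eps_bar, ← mul_assoc, eps_mul_self, one_mul, bar_bar,
    form_symm]

/-- The action is closed under transposition up to sign, so orthogonal complements of submodules are
submodules. -/
theorem form_Lop (i j : Idx m n) (p q : SPoly m n) :
    form m n (Lop i j p) q = eps i * eps j * form m n p (Lop (bar j) (bar i) q) := by
  simp only [Lop_apply, map_sub, map_smul, LinearMap.sub_apply, LinearMap.smul_apply,
    form_X_mul_eq_partialUp, form_partialUp, superSign_bar_left, superSign_bar_right,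
    smul_eq_mul, superSign_comm j i]
  ring

/-- For an odd pair the constants multiply to -4, and the derivatives come out in reversed order;
anticommuting them turns this into the 4 of the Laplacian. -/
theorem form_Rsq_mul (p q : SPoly m n) :
    form m n (Rsq m n * p) q = form m n p (laplacian m n q) := by
  simp only [Rsq_mul, laplacian_apply, map_sub, map_sum, map_smul, LinearMap.sub_apply,
    LinearMap.sum_apply, form_X_mul, metricCoeff]
  congr 1
  · simp
  · rw [Finset.smul_sum]
    refine Finset.sum_congr rfl fun j _ => ?_
    rw [partialX_comm]
    simp [superSign]
    ring

/-! ### The grading by degree -/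

/-- The span of the coordinate functions. -/
def linSpan (m n : ℕ) : Submodule ℝ (SPoly m n) := Submodule.span ℝ (Set.range X)

theorem linSpan_pow_succ (k : ℕ) : linSpan m n ^ (k + 1) = linSpan m n * linSpan m n ^ k :=
  pow_succ' (linSpan m n) k

theorem linSpan_pow_zero : linSpan m n ^ 0 = 1 := pow_zero (linSpan m n)

theorem X_mul_mem_pow {k : ℕ} (i : Idx m n) {p : SPoly m n} (hp : p ∈ linSpan m n ^ k) :
    X i * p ∈ linSpan m n ^ (k + 1) := by
  rw [linSpan_pow_succ]
  exact Submodule.mul_mem_mul (Submodule.subset_span ⟨i, rfl⟩) hp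

theorem span_mul_induction {ι : Type*} {f : ι → SPoly m n} {V : Submodule ℝ (SPoly m n)}
    {C : SPoly m n → Prop}
    (zero : C 0) (add : ∀ p q, C p → C q → C (p + q)) (mul : ∀ i, ∀ p ∈ V, C (f i * p))
    {p : SPoly m n} (hp : p ∈ Submodule.span ℝ (Set.range f) * V) : C p := by
  induction hp using Submodule.mul_induction_on' with
  | mem_mul_mem a ha b hb =>
    induction ha using Submodule.span_induction generalizing b with
    | mem a ha => obtain ⟨i, rfl⟩ := ha; exact mul i b hb
    | zero => simpa using zero
    | add x y _ _ hx hy => rw [add_mul]; exact add _ _ (hx b hb) (hy b hb)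
    | smul r x _ hx => rw [smul_mul_assoc, ← mul_smul_comm]; exact hx _ (V.smul_mem r hb)
  | add x _ y _ hx hy => exact add _ _ hx hy

theorem iSup_linSpan_pow : ⨆ k, linSpan m n ^ k = ⊤ := by
  rw [eq_top_iff]
  rintro p -
  induction p using spoly_induction with
  | one => exact Submodule.mem_iSup_of_mem 0 (by rw [linSpan_pow_zero]; exact Submodule.one_le.mp le_rfl)
  | add p q hp hq => exact Submodule.add_mem _ hp hq
  | smul r p hp => exact Submodule.smul_mem _ r hp
  | X_mul i p hp =>
    induction hp using Submodule.iSup_induction' with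
    | mem k x hx => exact Submodule.mem_iSup_of_mem (k + 1) (X_mul_mem_pow i hx)
    | zero => simp
    | add x y _ _ hx hy => rw [mul_add]; exact Submodule.add_mem _ hx hy

theorem mem_polyDeg {k : ℕ} {p : SPoly m n} :
    p ∈ polyDeg m n k ↔ euler m n p = (k : ℝ) • p := by
  rw [polyDeg, Module.End.mem_eigenspace_iff]

theorem X_mul_mem_polyDeg {k : ℕ} (i : Idx m n) {p : SPoly m n} (hp : p ∈ polyDeg m n k) :
    X i * p ∈ polyDeg m n (k + 1) := by
  rw [mem_polyDeg] at hp ⊢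
  rw [euler_X_mul, hp, mul_smul_comm]
  push_cast
  module

theorem partialX_mem_polyDeg {k : ℕ} (i : Idx m n) {p : SPoly m n}
    (hp : p ∈ polyDeg m n (k + 1)) : partialX i p ∈ polyDeg m n k := by
  rw [mem_polyDeg] at hp ⊢
  rw [euler_partialX, hp, map_smul]
  push_cast
  module

theorem linSpan_pow_le (k : ℕ) : linSpan m n ^ k ≤ polyDeg m n k := by
  induction k with
  | zero =>
    rw [linSpan_pow_zero, Submodule.one_le, mem_polyDeg, euler_apply]
    simp
  | succ k ih =>
    intro p hp
    rw [linSpan_pow_succ] at hp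
    exact span_mul_induction (C := fun p => p ∈ polyDeg m n (k + 1)) (Submodule.zero_mem _)
      (fun _ _ => Submodule.add_mem _) (fun i p hp => X_mul_mem_polyDeg i (ih hp)) hp

/-- The spans of monomials lie in the Euler eigenspaces and together exhaust the algebra; since
eigenspaces are independent, the inclusions are equalities. This yields finite dimension and
identifies degree 0 with the scalars. -/
theorem linSpan_pow_eq (k : ℕ) : linSpan m n ^ k = polyDeg m n k := by
  refine le_antisymm (linSpan_pow_le k) ?_
  have hind : iSupIndep (fun k : ℕ => polyDeg m n k) :=
    (Module.End.eigenspaces_iSupIndep (euler m n)).comp Nat.cast_injective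
  have htop : (linSpan m n ^ k) ⊔ ⨆ l, ⨆ (_ : l ≠ k), linSpan m n ^ l = ⊤ := by
    rw [eq_top_iff, ← iSup_linSpan_pow]
    refine iSup_le fun l => ?_
    by_cases h : l = k
    · subst h; exact le_sup_left
    · exact le_sup_of_le_right (le_iSup₂_of_le l h le_rfl)
  have hle : ⨆ l, ⨆ (_ : l ≠ k), linSpan m n ^ l ≤ ⨆ l, ⨆ (_ : l ≠ k), polyDeg m n l :=
    iSup₂_mono fun l _ => linSpan_pow_le l
  have hdis := (hind k).mono_right hle
  intro p hp
  obtain ⟨a, ha, b, hb, rfl⟩ := Submodule.mem_sup.mp (htop ▸ Submodule.mem_top : p ∈ _)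
  have hb' : b ∈ polyDeg m n k := by
    simpa using Submodule.sub_mem _ hp (linSpan_pow_le k ha)
  rw [Submodule.disjoint_def] at hdis
  rw [hdis b hb' hb, add_zero]
  exact ha

instance finite_polyDeg (k : ℕ) : FiniteDimensional ℝ (polyDeg m n k) := by
  rw [← linSpan_pow_eq, FiniteDimensional, Module.Finite.iff_fg]
  exact Submodule.FG.pow (Submodule.fg_span (Set.finite_range _)) k

theorem mem_polyDeg_zero {p : SPoly m n} : p ∈ polyDeg m n 0 ↔ ∃ c : ℝ, p = c • 1 := by
  rw [← linSpan_pow_eq, linSpan_pow_zero, Submodule.mem_one]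
  simp only [Algebra.algebraMap_eq_smul_one, eq_comm]

theorem partialX_of_mem_polyDeg_zero (i : Idx m n) {p : SPoly m n} (hp : p ∈ polyDeg m n 0) :
    partialX i p = 0 := by
  obtain ⟨c, rfl⟩ := mem_polyDeg_zero.mp hp
  simp

theorem Rsq_mul_mem_polyDeg {k : ℕ} {p : SPoly m n} (hp : p ∈ polyDeg m n k) :
    Rsq m n * p ∈ polyDeg m n (k + 2) := by
  rw [Rsq_mul]
  exact Submodule.sub_mem _
    (Submodule.sum_mem _ fun i _ => X_mul_mem_polyDeg _ (X_mul_mem_polyDeg _ hp))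
    (Submodule.sum_mem _ fun i _ => X_mul_mem_polyDeg _ (X_mul_mem_polyDeg _ hp))

theorem laplacian_mem_polyDeg {k : ℕ} {p : SPoly m n} (hp : p ∈ polyDeg m n (k + 2)) :
    laplacian m n p ∈ polyDeg m n k := by
  rw [laplacian_apply]
  exact Submodule.sub_mem _
    (Submodule.sum_mem _ fun i _ => partialX_mem_polyDeg _ (partialX_mem_polyDeg _ hp))
    (Submodule.smul_mem _ _
      (Submodule.sum_mem _ fun i _ => partialX_mem_polyDeg _ (partialX_mem_polyDeg _ hp)))

theorem laplacian_of_lt_two {k : ℕ} (hk : k < 2) {p : SPoly m n} (hp : p ∈ polyDeg m n k) :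
    laplacian m n p = 0 := by
  have h : ∀ i j : Idx m n, partialX i (partialX j p) = 0 := by
    intro i j
    interval_cases k
    · rw [partialX_of_mem_polyDeg_zero j hp, map_zero]
    · exact partialX_of_mem_polyDeg_zero i (partialX_mem_polyDeg j hp)
  simp [laplacian_apply, h]

theorem Lop_mem_polyDeg {k : ℕ} (i j : Idx m n) {p : SPoly m n} (hp : p ∈ polyDeg m n k) :
    Lop i j p ∈ polyDeg m n k := by
  rw [mem_polyDeg] at hp ⊢
  rw [euler_Lop, hp, map_smul]

/-! ### Nondegeneracy and separation by the form -/

theorem metricCoeff_ne_zero (i : Idx m n) : metricCoeff i ≠ 0 := by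
  rcases i with i | ⟨j, k⟩
  · simp [metricCoeff]
  · fin_cases k <;> simp [metricCoeff]

theorem eq_zero_of_partialX_eq_zero {k : ℕ} {p : SPoly m n} (hp : p ∈ polyDeg m n (k + 1))
    (h : ∀ i, partialX i p = 0) : p = 0 := by
  rw [mem_polyDeg, euler_apply] at hp
  simp only [h, mul_zero, Finset.sum_const_zero] at hp
  have hk : ((k + 1 : ℕ) : ℝ) ≠ 0 := by positivity
  exact (smul_eq_zero.mp hp.symm).resolve_left hk

/-- Transposing X_i shows inductively that all derivatives of q vanish; in positive degree the Euler
operator then gives q = 0. -/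
theorem eq_zero_of_form_eq_zero {k : ℕ} {q : SPoly m n} (hq : q ∈ polyDeg m n k)
    (h : ∀ p ∈ polyDeg m n k, form m n p q = 0) : q = 0 := by
  induction k generalizing q with
  | zero =>
    obtain ⟨c, rfl⟩ := mem_polyDeg_zero.mp hq
    have := h 1 (mem_polyDeg_zero.mpr ⟨1, by simp⟩)
    rw [map_smul, form_one_one, smul_eq_mul, mul_one] at this
    simp [this]
  | succ k ih =>
    refine eq_zero_of_partialX_eq_zero hq fun i => ih (partialX_mem_polyDeg i hq) fun p hp => ?_
    have := h _ (X_mul_mem_polyDeg i hp)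
    rw [form_X_mul] at this
    exact (mul_eq_zero.mp this).resolve_left (metricCoeff_ne_zero i)

theorem surjective_toDual_of_ker {V : Type*} [AddCommGroup V] [Module ℝ V]
    [FiniteDimensional ℝ V] (T : V →ₗ[ℝ] Module.Dual ℝ V) (hT : ∀ v, T v = 0 → v = 0) :
    Function.Surjective T :=
  (LinearMap.injective_iff_surjective_of_finrank_eq_finrank Subspace.dual_finrank_eq.symm).mp
    ((injective_iff_map_eq_zero T).mpr hT)

/-- A functional on the finite-dimensional degree-k part that vanishes on S but not at f is
represented by the form. -/
theorem exists_form_ne_zero {k : ℕ} {S : Submodule ℝ (SPoly m n)} {f : SPoly m n}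
    (hf : f ∈ polyDeg m n k) (hfS : f ∉ S) :
    ∃ h ∈ polyDeg m n k, (∀ p ∈ S, p ∈ polyDeg m n k → form m n p h = 0) ∧
      form m n f h ≠ 0 := by
  let V := polyDeg m n k
  let S' : Submodule ℝ V := S.comap V.subtype
  obtain ⟨φ, h1, h2⟩ := Submodule.exists_dual_map_eq_bot_of_notMem (p := S') (x := (⟨f, hf⟩ : V))
    hfS inferInstance
  let T : V →ₗ[ℝ] Module.Dual ℝ V :=
    ((form m n).flip.compl₂ V.subtype).comp V.subtype
  have hT' : Function.Surjective T := by
    refine surjective_toDual_of_ker (V := V) T ?_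
    rintro ⟨q, hq⟩ h
    ext1
    refine eq_zero_of_form_eq_zero hq fun p hp => ?_
    exact LinearMap.congr_fun h ⟨p, hp⟩
  obtain ⟨⟨h, hh⟩, rfl⟩ := hT' φ
  refine ⟨h, hh, fun p hpS hp => ?_, h1⟩
  have : T ⟨h, hh⟩ ⟨p, hp⟩ ∈ S'.map (T ⟨h, hh⟩) := ⟨_, hpS, rfl⟩
  rw [h2, Submodule.mem_bot] at this
  exact this

/-! ### The filtration by powers of the ideal (θ) -/

/-- The span of the odd coordinate functions. -/
def thetaSpan (m n : ℕ) : Submodule ℝ (SPoly m n) :=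
  Submodule.span ℝ (Set.range fun a : Fin n × Fin 2 => X (Sum.inr a))

/-- The filtration of super polynomials by powers of the ideal of the odd coordinates. -/
def thetaFilt (m n : ℕ) : ℕ → Submodule ℝ (SPoly m n)
  | 0 => ⊤
  | i + 1 => thetaSpan m n * thetaFilt m n i

theorem X_inr_mul_mem_thetaFilt {i : ℕ} (a : Fin n × Fin 2) {p : SPoly m n}
    (hp : p ∈ thetaFilt m n i) : X (Sum.inr a) * p ∈ thetaFilt m n (i + 1) :=
  Submodule.mul_mem_mul (Submodule.subset_span ⟨a, rfl⟩) hp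

theorem thetaFilt_succ_induction {i : ℕ} {C : SPoly m n → Prop} (zero : C 0)
    (add : ∀ p q, C p → C q → C (p + q))
    (mul : ∀ a, ∀ p ∈ thetaFilt m n i, C (X (Sum.inr a) * p))
    {p : SPoly m n} (hp : p ∈ thetaFilt m n (i + 1)) : C p :=
  span_mul_induction (f := fun a : Fin n × Fin 2 => X (Sum.inr a)) zero add mul hp

theorem thetaFilt_antitone : Antitone (thetaFilt m n) := by
  refine antitone_nat_of_succ_le fun i => ?_
  induction i with
  | zero => exact le_top
  | succ i ih =>
    intro p hp
    exact thetaFilt_succ_induction (C := fun p => p ∈ thetaFilt m n (i + 1))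
      (Submodule.zero_mem _) (fun _ _ => Submodule.add_mem _)
      (fun a q hq => X_inr_mul_mem_thetaFilt a (ih hq)) hp

theorem X_inl_mul_mem_thetaFilt {i : ℕ} (a : Fin m) {p : SPoly m n}
    (hp : p ∈ thetaFilt m n i) : X (Sum.inl a) * p ∈ thetaFilt m n i := by
  induction i generalizing p with
  | zero => trivial
  | succ i ih =>
    refine thetaFilt_succ_induction (C := fun p => X (Sum.inl a) * p ∈ thetaFilt m n (i + 1))
      (by simp) (fun p q hp hq => ?_) (fun b q hq => ?_) hp
    · rw [mul_add]; exact Submodule.add_mem _ hp hq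
    · rw [← X_inl_mul]; exact X_inr_mul_mem_thetaFilt b (ih hq)

theorem partialX_inl_mem_thetaFilt {i : ℕ} (a : Fin m) {p : SPoly m n}
    (hp : p ∈ thetaFilt m n i) : partialX (Sum.inl a) p ∈ thetaFilt m n i := by
  induction i generalizing p with
  | zero => trivial
  | succ i ih =>
    refine thetaFilt_succ_induction (C := fun p => partialX (Sum.inl a) p ∈ thetaFilt m n (i + 1))
      (by simp) (fun p q hp hq => ?_) (fun b q hq => ?_) hp
    · rw [map_add]; exact Submodule.add_mem _ hp hq
    · rw [partialX_X_mul]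
      simpa [superSign] using X_inr_mul_mem_thetaFilt b (ih hq)

theorem partialX_inr_mem_thetaFilt {i : ℕ} (a : Fin n × Fin 2) {p : SPoly m n}
    (hp : p ∈ thetaFilt m n (i + 1)) : partialX (Sum.inr a) p ∈ thetaFilt m n i := by
  induction i generalizing p with
  | zero => trivial
  | succ i ih =>
    refine thetaFilt_succ_induction (C := fun p => partialX (Sum.inr a) p ∈ thetaFilt m n (i + 1))
      (by simp) (fun p q hp hq => ?_) (fun b q hq => ?_) hp
    · rw [map_add]; exact Submodule.add_mem _ hp hq
    · rw [partialX_X_mul]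
      refine Submodule.add_mem _ ?_ (Submodule.smul_mem _ _ (X_inr_mul_mem_thetaFilt b (ih hq)))
      split_ifs
      · exact hq
      · exact Submodule.zero_mem _

/-- The Euler operator of the odd variables. -/
def oddEuler (m n : ℕ) : Module.End ℝ (SPoly m n) :=
  ∑ a : Fin n × Fin 2, LinearMap.mulLeft ℝ (X (Sum.inr a)) * partialX (Sum.inr a)

theorem oddEuler_apply (p : SPoly m n) :
    oddEuler m n p = ∑ a, X (Sum.inr a) * partialX (Sum.inr a) p := by
  simp [oddEuler, LinearMap.sum_apply]

theorem oddEuler_X_inr_mul (b : Fin n × Fin 2) (p : SPoly m n) :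
    oddEuler m n (X (Sum.inr b) * p) = X (Sum.inr b) * oddEuler m n p + X (Sum.inr b) * p := by
  simp only [oddEuler_apply, partialX_X_mul, mul_add, Finset.sum_add_distrib, Finset.mul_sum]
  rw [add_comm]
  congr 1
  · refine Finset.sum_congr rfl fun l _ => ?_
    rw [mul_smul_comm, X_mul_X_mul (Sum.inr l), smul_smul, superSign_mul_self, one_smul]
  · simp [mul_ite]

/-- On the i-th graded piece of the filtration the odd Euler operator is the scalar i. -/
theorem oddEuler_sub_mem_thetaFilt {i : ℕ} {p : SPoly m n} (hp : p ∈ thetaFilt m n i) :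
    oddEuler m n p - (i : ℝ) • p ∈ thetaFilt m n (i + 1) := by
  induction i generalizing p with
  | zero =>
    rw [Nat.cast_zero, zero_smul, sub_zero, oddEuler_apply]
    exact Submodule.sum_mem _ fun a _ => X_inr_mul_mem_thetaFilt a trivial
  | succ i ih =>
    refine thetaFilt_succ_induction
      (C := fun p => oddEuler m n p - ((i + 1 : ℕ) : ℝ) • p ∈ thetaFilt m n (i + 1 + 1))
      (by simp) (fun p q hp hq => ?_) (fun b q hq => ?_) hp
    · have := Submodule.add_mem _ hp hq
      rw [map_add, smul_add]
      convert this using 1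
      abel
    · convert X_inr_mul_mem_thetaFilt b (ih hq) using 1
      rw [oddEuler_X_inr_mul, mul_sub, mul_smul_comm]
      push_cast
      module

theorem exteriorPower_eq_bot : ⋀[ℝ]^(2 * n + 1) (Fin n × Fin 2 → ℝ) = ⊥ := by
  rw [← Submodule.finrank_eq_zero (R := ℝ), exteriorPower.finrank_eq]
  simp [mul_comm]

theorem thetaFilt_le_map (i : ℕ) : thetaFilt m n i ≤
    (⋀[ℝ]^i (Fin n × Fin 2 → ℝ)).map (Algebra.TensorProduct.includeRight :
      ExteriorAlgebra ℝ (Fin n × Fin 2 → ℝ) →ₐ[ℝ] SPoly m n).toLinearMap * ⊤ := by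
  induction i with
  | zero =>
    intro p _
    rw [← one_mul p]
    refine Submodule.mul_mem_mul ⟨1, ?_, rfl⟩ trivial
    simp
  | succ i ih =>
    intro p hp
    refine thetaFilt_succ_induction
      (C := fun p => p ∈ (⋀[ℝ]^(i + 1) (Fin n × Fin 2 → ℝ)).map
        (Algebra.TensorProduct.includeRight :
      ExteriorAlgebra ℝ (Fin n × Fin 2 → ℝ) →ₐ[ℝ] SPoly m n).toLinearMap * ⊤)
      (Submodule.zero_mem _) (fun _ _ => Submodule.add_mem _) (fun a q hq => ?_) hp
    have hq' := ih hq
    clear hq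
    induction hq' using Submodule.mul_induction_on' with
    | mem_mul_mem u hu v hv =>
      rw [← mul_assoc]
      refine Submodule.mul_mem_mul ?_ trivial
      obtain ⟨w, hw, rfl⟩ := hu
      refine ⟨ExteriorAlgebra.ι ℝ (Pi.single a 1) * w, ?_, by simp [X]⟩
      rw [SetLike.mem_coe, ExteriorAlgebra.exteriorPower, pow_succ']
      exact Submodule.mul_mem_mul ⟨_, rfl⟩ hw
    | add x _ y _ hx hy => rw [mul_add]; exact Submodule.add_mem _ hx hy

theorem thetaFilt_eq_bot : thetaFilt m n (2 * n + 1) = ⊥ := by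
  rw [eq_bot_iff]
  refine (thetaFilt_le_map _).trans ?_
  rw [exteriorPower_eq_bot]
  simp

/-! ### Submodules contained in (R²) + (θ) -/

/-- Composition of the operators `T a`, the head of the list being applied first. -/
def word {A : Type*} (T : A → Module.End ℝ (SPoly m n)) : List A → Module.End ℝ (SPoly m n)
  | [] => 1
  | a :: l => word T l * T a

/-- The ideal generated by `R²`. -/
def rsqIdeal (m n : ℕ) : Submodule ℝ (SPoly m n) := LinearMap.range (LinearMap.mulLeft ℝ (Rsq m n))

theorem X_inr_mul_mem_rsqIdeal_sup {i : ℕ} (a : Fin n × Fin 2) {p : SPoly m n}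
    (hp : p ∈ rsqIdeal m n ⊔ thetaFilt m n i) :
    X (Sum.inr a) * p ∈ rsqIdeal m n ⊔ thetaFilt m n (i + 1) := by
  obtain ⟨_, ⟨g, rfl⟩, q, hq, rfl⟩ := Submodule.mem_sup.mp hp
  rw [mul_add, LinearMap.mulLeft_apply, X_mul_Rsq_mul]
  exact Submodule.add_mem_sup ⟨_, rfl⟩ (X_inr_mul_mem_thetaFilt a hq)

/-- Modulo the next filtration step, f is a nonzero multiple of ∑ θ_a ∂_{θ_a} f, so induction
applies to the derivatives ∂_{θ_a} f. -/
theorem mem_sup_thetaFilt_succ {i : ℕ} {f : SPoly m n} (hf : f ∈ thetaFilt m n i)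
    (h : ∀ l : List (Fin n × Fin 2), l.length = i →
      word (fun a => partialX (Sum.inr a)) l f ∈ rsqIdeal m n ⊔ thetaFilt m n 1) :
    f ∈ rsqIdeal m n ⊔ thetaFilt m n (i + 1) := by
  induction i generalizing f with
  | zero => simpa [word] using h [] rfl
  | succ i ih =>
    have h1 : oddEuler m n f ∈ rsqIdeal m n ⊔ thetaFilt m n (i + 1 + 1) := by
      rw [oddEuler_apply]
      refine Submodule.sum_mem _ fun a _ => X_inr_mul_mem_rsqIdeal_sup a
        (ih (partialX_inr_mem_thetaFilt a hf) fun l hl => ?_)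
      simpa [word] using h (a :: l) (by simp [hl])
    have h2 := Submodule.sub_mem _ h1 (Submodule.mem_sup_right (S := rsqIdeal m n)
      (oddEuler_sub_mem_thetaFilt hf))
    rw [sub_sub_cancel] at h2
    exact (Submodule.smul_mem_iff _ (by positivity)).mp h2

/-- The body map, killing the odd coordinates. -/
def body (m n : ℕ) : SPoly m n →ₐ[ℝ] MvPolynomial (Fin m) ℝ :=
  (Algebra.TensorProduct.rid ℝ ℝ (MvPolynomial (Fin m) ℝ)).toAlgHom.comp
    (Algebra.TensorProduct.map (AlgHom.id ℝ _) ExteriorAlgebra.algebraMapInv)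

theorem body_X_inl (i : Fin m) : body m n (X (Sum.inl i)) = MvPolynomial.X i := by
  simp [body, X]

theorem body_X_inr (a : Fin n × Fin 2) : body m n (X (Sum.inr a)) = 0 := by
  simp [body, X, ExteriorAlgebra.algebraMapInv]

theorem body_Rsq : body m n (Rsq m n) = ∑ i : Fin m, MvPolynomial.X i ^ 2 := by
  simp [Rsq, body_X_inl, body_X_inr]

theorem body_eq_zero_of_mem {p : SPoly m n} (hp : p ∈ thetaFilt m n 1) : body m n p = 0 :=
  thetaFilt_succ_induction (C := fun p => body m n p = 0) (map_zero _)
    (fun p q hp hq => by rw [map_add, hp, hq, add_zero])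
    (fun a p _ => by rw [map_mul, body_X_inr, zero_mul]) hp

theorem sub_body_mem (p : SPoly m n) : p - (body m n p) ⊗ₜ 1 ∈ thetaFilt m n 1 := by
  induction p using spoly_induction with
  | one =>
    rw [map_one, ← Algebra.TensorProduct.one_def, sub_self]
    exact Submodule.zero_mem _
  | add p q hp hq =>
    convert Submodule.add_mem _ hp hq using 1
    rw [map_add, TensorProduct.add_tmul]
    abel
  | smul r p hp =>
    convert Submodule.smul_mem _ r hp using 1
    rw [map_smul, ← TensorProduct.smul_tmul', smul_sub]
  | X_mul i p hp =>
    rcases i with i | a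
    · convert X_inl_mul_mem_thetaFilt i hp using 1
      rw [map_mul, body_X_inl, mul_sub]
      simp [X]
    · rw [map_mul, body_X_inr, zero_mul, TensorProduct.zero_tmul, sub_zero]
      exact X_inr_mul_mem_thetaFilt a trivial

theorem mem_rsqIdeal_sup_iff {p : SPoly m n} : p ∈ rsqIdeal m n ⊔ thetaFilt m n 1 ↔
    (∑ i : Fin m, MvPolynomial.X i ^ 2) ∣ body m n p := by
  constructor
  · intro hp
    obtain ⟨_, ⟨g, rfl⟩, q, hq, rfl⟩ := Submodule.mem_sup.mp hp
    rw [map_add, body_eq_zero_of_mem hq, add_zero, LinearMap.mulLeft_apply, map_mul, body_Rsq]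
    exact dvd_mul_right _ _
  · rintro ⟨g, hg⟩
    have h := sub_body_mem (p - Rsq m n * (g ⊗ₜ 1))
    have h0 : body m n (g ⊗ₜ[ℝ] 1) = g := by simp [body]
    rw [map_sub, map_mul, body_Rsq, h0, hg, sub_self, TensorProduct.zero_tmul, sub_zero] at h
    rw [← add_sub_cancel (Rsq m n * (g ⊗ₜ 1)) p]
    exact Submodule.add_mem_sup ⟨_, rfl⟩ h

theorem not_X_dvd_sum_sq (hm : 2 ≤ m) (i : Fin m) :
    ¬ (MvPolynomial.X i : MvPolynomial (Fin m) ℝ) ∣ ∑ l : Fin m, MvPolynomial.X l ^ 2 := by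
  rintro ⟨g, hg⟩
  have : Nontrivial (Fin m) := Fin.nontrivial_iff_two_le.mpr hm
  obtain ⟨j, hj⟩ := exists_ne i
  have := congrArg (MvPolynomial.eval (Pi.single j (1 : ℝ))) hg
  simp [Ne.symm hj, Pi.single_apply] at this

/-- Only primality of x_i is used, together with x_i ∤ ∑ x_l²; the latter needs a second bosonic
variable. -/
theorem sum_sq_dvd_of_dvd_X_mul (hm : 2 ≤ m) (i : Fin m) {q : MvPolynomial (Fin m) ℝ}
    (h : (∑ l : Fin m, MvPolynomial.X l ^ 2) ∣ MvPolynomial.X i * q) :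
    (∑ l : Fin m, MvPolynomial.X l ^ 2) ∣ q := by
  obtain ⟨g, hg⟩ := h
  have hp : Prime (MvPolynomial.X i : MvPolynomial (Fin m) ℝ) := MvPolynomial.X_prime
  obtain ⟨g', rfl⟩ := (hp.dvd_or_dvd ⟨q, hg.symm⟩).resolve_left (not_X_dvd_sum_sq hm i)
  refine ⟨g', mul_left_cancel₀ hp.ne_zero ?_⟩
  rw [hg]
  ring

theorem mem_of_X_inl_pow_mul_mem (hm : 2 ≤ m) (i : Fin m) (l : ℕ) {p : SPoly m n}
    (h : X (Sum.inl i) ^ l * p ∈ rsqIdeal m n ⊔ thetaFilt m n 1) :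
    p ∈ rsqIdeal m n ⊔ thetaFilt m n 1 := by
  induction l with
  | zero => simpa using h
  | succ l ih =>
    apply ih
    rw [mem_rsqIdeal_sup_iff] at h ⊢
    rw [pow_succ', mul_assoc, map_mul, body_X_inl] at h
    exact sum_sq_dvd_of_dvd_X_mul hm i h

/-- The rotation mixing `x_i` and `θ_a`, normalized to have leading part `x_i ∂_{θ_a}`. -/
def lower (i : Fin m) (a : Fin n × Fin 2) : Module.End ℝ (SPoly m n) :=
  (metricCoeff (m := m) (bar (Sum.inr a)))⁻¹ • Lop (Sum.inl i) (bar (Sum.inr a))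

theorem lower_apply (i : Fin m) (a : Fin n × Fin 2) (p : SPoly m n) :
    lower i a p = X (Sum.inl i) * partialX (Sum.inr a) p -
      (metricCoeff (m := m) (bar (Sum.inr a)))⁻¹ •
        (X (bar (Sum.inr a)) * partialX (Sum.inl i) p) := by
  have h : partialUp (Sum.inl i : Idx m n) = partialX (Sum.inl i) := rfl
  have h2 : superSign (Sum.inl i : Idx m n) (bar (Sum.inr a)) = 1 := by simp [superSign]
  rw [lower, LinearMap.smul_apply, Lop_apply, h, h2, partialUp_eq, bar_bar, LinearMap.smul_apply,
    mul_smul_comm, one_smul, smul_sub, smul_smul, inv_mul_cancel₀ (metricCoeff_ne_zero _), one_smul]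

theorem word_partialX_mem {i : ℕ} (l : List (Fin n × Fin 2)) {p : SPoly m n}
    (hp : p ∈ thetaFilt m n (i + l.length)) :
    word (fun a => partialX (Sum.inr a)) l p ∈ thetaFilt m n i := by
  induction l generalizing p with
  | nil => exact hp
  | cons a l ih => exact ih (partialX_inr_mem_thetaFilt a hp)

theorem word_partialX_X_inl_mul (i : Fin m) (l : List (Fin n × Fin 2)) (p : SPoly m n) :
    word (fun a => partialX (Sum.inr a)) l (X (Sum.inl i) * p) =
      X (Sum.inl i) * word (fun a => partialX (Sum.inr a)) l p := by
  induction l generalizing p with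
  | nil => rfl
  | cons a l ih =>
    simp only [word, Module.End.mul_apply]
    rw [← ih, partialX_X_mul]
    simp [superSign]

/-- The second term of each rotation raises the θ-order instead of lowering it. A word as long as
the θ-order of p therefore sees only the leading parts x_i ∂_{θ_a}, up to terms in (θ). -/
theorem word_lower_sub_mem (i : Fin m) (l : List (Fin n × Fin 2)) {p : SPoly m n}
    (hp : p ∈ thetaFilt m n l.length) :
    word (lower i) l p - X (Sum.inl i) ^ l.length * word (fun a => partialX (Sum.inr a)) l p ∈
      thetaFilt m n 1 := by
  induction l generalizing p with
  | nil => simp [word]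
  | cons a l ih =>
    have h0 : X (bar (Sum.inr a)) * partialX (Sum.inl i) p ∈ thetaFilt m n (2 + l.length) := by
      rw [add_comm]
      exact X_inr_mul_mem_thetaFilt _ (partialX_inl_mem_thetaFilt i hp)
    have h1 := ih (X_inl_mul_mem_thetaFilt i (partialX_inr_mem_thetaFilt a hp))
    have h2 := ih (thetaFilt_antitone (Nat.le_add_left _ _) h0)
    have h3 : X (Sum.inl i) ^ l.length * word (fun a => partialX (Sum.inr a)) l
        (X (bar (Sum.inr a)) * partialX (Sum.inl i) p) ∈ thetaFilt m n 1 := by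
      have hx : ∀ (t : ℕ) (q : SPoly m n), q ∈ thetaFilt m n 1 →
          X (Sum.inl i) ^ t * q ∈ thetaFilt m n 1 := by
        intro t q hq
        induction t with
        | zero => simpa using hq
        | succ t ih => rw [pow_succ', mul_assoc]; exact X_inl_mul_mem_thetaFilt i ih
      exact hx _ _ (thetaFilt_antitone one_le_two (word_partialX_mem l h0))
    have h4 := Submodule.sub_mem _ h1 (Submodule.smul_mem _
      (metricCoeff (m := m) (bar (Sum.inr a)))⁻¹ (Submodule.add_mem _ h2 h3))
    convert h4 using 1
    simp only [word, Module.End.mul_apply, lower_apply, map_sub, map_smul, List.length_cons,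
      word_partialX_X_inl_mul, pow_succ, mul_assoc, sub_add_cancel]
    abel

theorem word_mem {A : Type*} {T : A → Module.End ℝ (SPoly m n)} {U : Submodule ℝ (SPoly m n)}
    (h : ∀ a, ∀ u ∈ U, T a u ∈ U) (l : List A) {u : SPoly m n} (hu : u ∈ U) : word T l u ∈ U := by
  induction l generalizing u with
  | nil => exact hu
  | cons a l ih => exact ih (h a u hu)

theorem word_lower_Rsq_mul (i : Fin m) (l : List (Fin n × Fin 2)) (p : SPoly m n) :
    word (lower i) l (Rsq m n * p) = Rsq m n * word (lower i) l p := by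
  induction l generalizing p with
  | nil => rfl
  | cons a l ih =>
    simp only [word, Module.End.mul_apply]
    rw [← ih, lower, LinearMap.smul_apply, Lop_Rsq_mul, LinearMap.smul_apply, mul_smul_comm]

/-- The θ-order of the part outside (R²) can be pushed up one step at a time: rotations bring it
down to order 0, where the hypothesis on U applies. The ideal (θ) is nilpotent, so finally only (R²)
remains. -/
theorem le_rsqIdeal_of_isOspModule (hm : 2 ≤ m) {U : Submodule ℝ (SPoly m n)}
    (hU : IsOspModule U) (h : U ≤ rsqIdeal m n ⊔ thetaFilt m n 1) : U ≤ rsqIdeal m n := by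
  rw [isOspModule_iff] at hU
  let i₀ : Fin m := ⟨0, by omega⟩
  have key : ∀ i, U ≤ rsqIdeal m n ⊔ thetaFilt m n (i + 1) := by
    intro i
    induction i with
    | zero => exact h
    | succ i ih =>
      intro f hf
      obtain ⟨_, ⟨g, rfl⟩, f', hf', rfl⟩ := Submodule.mem_sup.mp (ih hf)
      refine Submodule.add_mem _ (Submodule.mem_sup_left ⟨g, rfl⟩) ?_
      refine mem_sup_thetaFilt_succ hf' fun l hl => ?_
      -- Rotating f stays in U and rotating R²g stays in (R²). Hence a power of x_{i₀} times the
      -- iterated odd derivative of f' lies in (R²) + (θ), and the power cancels.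
      apply mem_of_X_inl_pow_mul_mem hm i₀ l.length
      have h1 := h (word_mem (T := lower i₀) (fun a u hu => Submodule.smul_mem _ _ (hU _ _ u hu))
        l hf)
      rw [LinearMap.mulLeft_apply, map_add, word_lower_Rsq_mul] at h1
      have h2 := Submodule.sub_mem _ h1 (Submodule.mem_sup_left (T := thetaFilt m n 1)
        (show Rsq m n * word (lower i₀) l g ∈ rsqIdeal m n from ⟨_, rfl⟩))
      rw [add_sub_cancel_left] at h2
      have h3 := Submodule.sub_mem _ h2 (Submodule.mem_sup_right (S := rsqIdeal m n)
        (word_lower_sub_mem i₀ l (hl ▸ hf')))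
      rwa [sub_sub_cancel] at h3
  have := key (2 * n)
  rwa [thetaFilt_eq_bot, sup_bot_eq] at this

/-! ### Orthogonal complements and generation by bosonic harmonics -/

/-- The orthogonal complement of `V` within the super polynomials of degree `k`. -/
def formPerp (V : Submodule ℝ (SPoly m n)) (k : ℕ) : Submodule ℝ (SPoly m n) where
  carrier := {q | q ∈ polyDeg m n k ∧ ∀ v ∈ V, v ∈ polyDeg m n k → form m n v q = 0}
  zero_mem' := ⟨Submodule.zero_mem _, fun v _ _ => by simp⟩
  add_mem' := fun ha hb => ⟨Submodule.add_mem _ ha.1 hb.1, fun v hv hv' => by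
    rw [map_add, ha.2 v hv hv', hb.2 v hv hv', add_zero]⟩
  smul_mem' := fun r a ha => ⟨Submodule.smul_mem _ r ha.1, fun v hv hv' => by
    rw [map_smul, ha.2 v hv hv', smul_zero]⟩

theorem isOspModule_formPerp {V : Submodule ℝ (SPoly m n)} (hV : IsOspModule V) (k : ℕ) :
    IsOspModule (formPerp V k) := by
  rw [isOspModule_iff] at hV ⊢
  rintro i j q ⟨hq, h⟩
  refine ⟨Lop_mem_polyDeg i j hq, fun v hv hv' => ?_⟩
  rw [form_symm, form_Lop, form_symm, h _ (hV _ _ v hv) (Lop_mem_polyDeg _ _ hv'), mul_zero]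

/-- Super polynomials of degree `k` in the bosonic variables only. -/
def pureDeg (m n k : ℕ) : Submodule ℝ (SPoly m n) :=
  polyDeg m n k ⊓ ⨅ a : Fin n × Fin 2, LinearMap.ker (partialX (Sum.inr a))

theorem mem_pureDeg {k : ℕ} {p : SPoly m n} :
    p ∈ pureDeg m n k ↔ p ∈ polyDeg m n k ∧ ∀ a, partialX (Sum.inr a) p = 0 := by
  simp [pureDeg]

theorem mem_harmonics {k : ℕ} {p : SPoly m n} :
    p ∈ harmonics m n k ↔ p ∈ polyDeg m n k ∧ laplacian m n p = 0 := by
  simp [harmonics]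

/-- By adjunction, orthogonality to (R²) means ∇² t = 0 and orthogonality to (θ) means that all odd
derivatives vanish. -/
theorem mem_harmonics_inf_pureDeg {k : ℕ} {t : SPoly m n} (ht : t ∈ polyDeg m n k)
    (h : ∀ p ∈ rsqIdeal m n ⊔ thetaFilt m n 1, p ∈ polyDeg m n k → form m n p t = 0) :
    t ∈ harmonics m n k ∧ t ∈ pureDeg m n k := by
  rw [mem_harmonics, mem_pureDeg]
  refine ⟨⟨ht, ?_⟩, ht, fun a => ?_⟩
  · rcases lt_or_ge k 2 with hk | hk
    · exact laplacian_of_lt_two hk ht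
    · obtain ⟨k, rfl⟩ := Nat.exists_eq_add_of_le' hk
      refine eq_zero_of_form_eq_zero (laplacian_mem_polyDeg ht) fun p hp => ?_
      rw [← form_Rsq_mul]
      exact h _ (Submodule.mem_sup_left ⟨p, rfl⟩) (Rsq_mul_mem_polyDeg hp)
  · cases k with
    | zero => exact partialX_of_mem_polyDeg_zero _ ht
    | succ k =>
      refine eq_zero_of_form_eq_zero (partialX_mem_polyDeg _ ht) fun p hp => ?_
      have := h _ (Submodule.mem_sup_right (X_inr_mul_mem_thetaFilt (i := 0) a trivial))
        (X_mul_mem_polyDeg (Sum.inr a) hp)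
      rw [form_X_mul] at this
      exact (mul_eq_zero.mp this).resolve_left (metricCoeff_ne_zero _)

/-- The bosonic harmonics generate the module of all harmonics. -/
theorem harmonics_le_of_pureDeg_le (hm : 2 ≤ m) {k : ℕ} {V : Submodule ℝ (SPoly m n)}
    (hV : IsOspModule V) (h : ∀ t ∈ harmonics m n k, t ∈ pureDeg m n k → t ∈ V) :
    harmonics m n k ≤ V := by
  intro f hf
  by_contra hfV
  obtain ⟨hf1, hf2⟩ := mem_harmonics.mp hf
  obtain ⟨q, hq, hqV, hfq⟩ := exists_form_ne_zero hf1 hfV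
  -- An element of the complement outside this ideal would pair nontrivially with some θ-free
  -- harmonic t, but t lies in V.
  have hle : formPerp V k ≤ rsqIdeal m n ⊔ thetaFilt m n 1 := by
    rintro u ⟨hu, hu'⟩
    by_contra hcon
    obtain ⟨t, ht, ht', hne⟩ := exists_form_ne_zero hu hcon
    obtain ⟨h1, h2⟩ := mem_harmonics_inf_pureDeg ht ht'
    rw [form_symm] at hne
    exact hne (hu' t (h t h1 h2) ht)
  -- Now q is a multiple of R², hence orthogonal to the harmonic f, contrary to its choice.
  obtain ⟨g, rfl⟩ := le_rsqIdeal_of_isOspModule hm (isOspModule_formPerp hV k) hle ⟨hq, hqV⟩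
  rw [form_symm, LinearMap.mulLeft_apply, form_Rsq_mul, hf2, map_zero] at hfq
  exact hfq rfl

/-! ### The Casimir operator of 𝔰𝔬(m) separates bosonic degrees -/

/-- The Euler operator of the bosonic variables. -/
def evenEuler (m n : ℕ) : Module.End ℝ (SPoly m n) :=
  ∑ i : Fin m, LinearMap.mulLeft ℝ (X (Sum.inl i)) * partialX (Sum.inl i)

/-- The Laplace operator of the bosonic variables. -/
def evenLaplacian (m n : ℕ) : Module.End ℝ (SPoly m n) :=
  ∑ i : Fin m, partialX (Sum.inl i) * partialX (Sum.inl i)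

/-- The Casimir operator of `𝔰𝔬(m)`, up to normalization. -/
def casimir (m n : ℕ) : Module.End ℝ (SPoly m n) :=
  ∑ i : Fin m, ∑ j : Fin m, Lop (Sum.inl i) (Sum.inl j) * Lop (Sum.inl i) (Sum.inl j)

theorem evenEuler_apply (p : SPoly m n) :
    evenEuler m n p = ∑ i, X (Sum.inl i) * partialX (Sum.inl i) p := by
  simp [evenEuler, LinearMap.sum_apply]

theorem evenLaplacian_apply (p : SPoly m n) :
    evenLaplacian m n p = ∑ i, partialX (Sum.inl i) (partialX (Sum.inl i) p) := by
  simp [evenLaplacian, LinearMap.sum_apply]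

theorem casimir_apply (p : SPoly m n) : casimir m n p = ∑ i : Fin m, ∑ j : Fin m,
    Lop (Sum.inl i) (Sum.inl j) (Lop (Sum.inl i) (Sum.inl j) p) := by
  simp [casimir, LinearMap.sum_apply]

theorem evenEuler_X_inl_mul (i : Fin m) (p : SPoly m n) :
    evenEuler m n (X (Sum.inl i) * p) =
      X (Sum.inl i) * evenEuler m n p + X (Sum.inl i) * p := by
  simp only [evenEuler_apply, partialX_X_mul, mul_add, Finset.sum_add_distrib, Finset.mul_sum]
  rw [add_comm]
  congr 1
  · refine Finset.sum_congr rfl fun l _ => ?_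
    rw [mul_smul_comm, X_mul_X_mul (Sum.inl l), smul_smul, superSign_mul_self, one_smul]
  · simp [mul_ite]

theorem evenEuler_X_inr_mul (a : Fin n × Fin 2) (p : SPoly m n) :
    evenEuler m n (X (Sum.inr a) * p) = X (Sum.inr a) * evenEuler m n p := by
  simp only [evenEuler_apply, partialX_X_mul, Finset.mul_sum]
  refine Finset.sum_congr rfl fun l _ => ?_
  simp [superSign, X_inl_mul]

theorem evenEuler_partialX_inl (i : Fin m) (p : SPoly m n) :
    evenEuler m n (partialX (Sum.inl i) p) =
      partialX (Sum.inl i) (evenEuler m n p) - partialX (Sum.inl i) p := by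
  rw [eq_sub_iff_add_eq]
  simp only [evenEuler_apply, partialX_X_mul, map_sum, Finset.sum_add_distrib]
  rw [add_comm]
  congr 1
  · simp
  · refine Finset.sum_congr rfl fun l _ => ?_
    rw [partialX_comm (Sum.inl i) (Sum.inl l), mul_smul_comm, smul_smul, superSign_mul_self,
      one_smul]

theorem evenEuler_evenLaplacian (p : SPoly m n) : evenEuler m n (evenLaplacian m n p) =
    evenLaplacian m n (evenEuler m n p) - (2 : ℝ) • evenLaplacian m n p := by
  simp only [evenLaplacian_apply, map_sum, Finset.smul_sum, ← Finset.sum_sub_distrib]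
  refine Finset.sum_congr rfl fun i _ => ?_
  rw [evenEuler_partialX_inl, evenEuler_partialX_inl, map_sub]
  module

theorem Lop_inl_inl_apply (i j : Fin m) (p : SPoly m n) : Lop (Sum.inl i) (Sum.inl j) p =
    X (Sum.inl i) * partialX (Sum.inl j) p - X (Sum.inl j) * partialX (Sum.inl i) p := by
  rw [Lop_apply]
  simp [superSign, partialUp]

/-- Expanding the squares gives two copies each of ∑ x_i∂_j x_i∂_j = r²Δ + E and, with a minus sign,
∑ x_i∂_j x_j∂_i = E² + (m-1)E. -/
theorem casimir_eq (p : SPoly m n) : casimir m n p =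
    (2 : ℝ) • ((∑ i : Fin m, X (Sum.inl i) ^ 2) * evenLaplacian m n p) -
      (2 : ℝ) • (evenEuler m n (evenEuler m n p) + ((m : ℝ) - 2) • evenEuler m n p) := by
  have hA : ∑ i : Fin m, ∑ j : Fin m, X (Sum.inl i) * partialX (Sum.inl j)
      (X (Sum.inl i) * partialX (Sum.inl j) p) =
      (∑ i : Fin m, X (Sum.inl i) ^ 2) * evenLaplacian m n p + evenEuler m n p := by
    rw [evenLaplacian_apply, evenEuler_apply, Finset.sum_mul, ← Finset.sum_add_distrib]
    refine Finset.sum_congr rfl fun i _ => ?_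
    simp only [partialX_X_mul, mul_add, Finset.sum_add_distrib, Finset.mul_sum, pow_two, mul_assoc]
    rw [add_comm]
    congr 1
    · simp [superSign]
    · simp [mul_ite]
  have hE : evenEuler m n (evenEuler m n p) = evenEuler m n p + ∑ i : Fin m, ∑ j : Fin m,
      X (Sum.inl i) * (X (Sum.inl j) * partialX (Sum.inl j) (partialX (Sum.inl i) p)) := by
    conv_lhs => rw [evenEuler_apply p, map_sum]
    simp only [evenEuler_X_inl_mul, Finset.sum_add_distrib]
    rw [add_comm, evenEuler_apply p]
    congr 1
    refine Finset.sum_congr rfl fun i _ => ?_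
    rw [evenEuler_apply, Finset.mul_sum]
  have hB : ∑ i : Fin m, ∑ j : Fin m, X (Sum.inl i) * partialX (Sum.inl j)
      (X (Sum.inl j) * partialX (Sum.inl i) p) =
      evenEuler m n (evenEuler m n p) + ((m : ℝ) - 1) • evenEuler m n p := by
    rw [hE]
    simp only [partialX_X_mul, mul_add, Finset.sum_add_distrib, if_true, Finset.sum_const,
      Finset.card_univ, Fintype.card_fin, superSign, one_smul]
    rw [← Finset.smul_sum, ← evenEuler_apply, ← Nat.cast_smul_eq_nsmul ℝ]
    module
  have hA' := hA
  have hB' := hB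
  rw [Finset.sum_comm] at hA' hB'
  simp only [casimir_apply, Lop_inl_inl_apply, map_sub, Finset.sum_sub_distrib]
  rw [hA, hB, hA', hB']
  module

theorem iSup_eigenspace_evenEuler :
    ⨆ d : ℕ, Module.End.eigenspace (evenEuler m n) (d : ℝ) = ⊤ := by
  rw [eq_top_iff]
  rintro p -
  induction p using spoly_induction with
  | one =>
    refine Submodule.mem_iSup_of_mem 0 ?_
    rw [Module.End.mem_eigenspace_iff, evenEuler_apply]
    simp
  | add p q hp hq => exact Submodule.add_mem _ hp hq
  | smul r p hp => exact Submodule.smul_mem _ r hp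
  | X_mul i p hp =>
    induction hp using Submodule.iSup_induction' with
    | mem d x hx =>
      rw [Module.End.mem_eigenspace_iff] at hx
      rcases i with i | a
      · refine Submodule.mem_iSup_of_mem (d + 1) ?_
        rw [Module.End.mem_eigenspace_iff, evenEuler_X_inl_mul, hx, mul_smul_comm]
        push_cast
        module
      · refine Submodule.mem_iSup_of_mem d ?_
        rw [Module.End.mem_eigenspace_iff, evenEuler_X_inr_mul, hx, mul_smul_comm]
    | zero => simp
    | add x y _ _ hx hy => rw [mul_add]; exact Submodule.add_mem _ hx hy

theorem eq_zero_of_evenEuler_neg {μ : ℝ} (hμ : μ < 0) {p : SPoly m n}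
    (hp : evenEuler m n p = μ • p) : p = 0 := by
  have hind := Module.End.eigenspaces_iSupIndep (evenEuler m n) μ
  rw [Submodule.disjoint_def] at hind
  refine hind p (Module.End.mem_eigenspace_iff.mpr hp) ?_
  have : (⊤ : Submodule ℝ (SPoly m n)) ≤
      ⨆ ν, ⨆ (_ : ν ≠ μ), Module.End.eigenspace (evenEuler m n) ν := by
    rw [← iSup_eigenspace_evenEuler]
    refine iSup_le fun d => le_iSup₂_of_le (d : ℝ) ?_ le_rfl
    have : (0 : ℝ) ≤ d := d.cast_nonneg
    linarith
  exact this trivial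

/-- The eigenvalue parameter of the Casimir operator in degree `d`. -/
def casimirVal (m d : ℕ) : ℝ := 2 * ((d : ℝ) * d + ((m : ℝ) - 2) * d)

/-- Strictness needs m ≥ 2: for m = 1 the values in degrees 0 and 1 coincide. -/
theorem casimirVal_lt (hm : 2 ≤ m) {i k : ℕ} (h : i < k) : casimirVal m i < casimirVal m k := by
  have h1 : (i : ℝ) < k := by exact_mod_cast h
  have h2 : (2 : ℝ) ≤ m := by exact_mod_cast hm
  have h3 : (0 : ℝ) ≤ i := i.cast_nonneg
  unfold casimirVal
  nlinarith [mul_nonneg (sub_nonneg.mpr h2) (sub_nonneg.mpr h1.le)]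

/-- The polynomial annihilating the Casimir components of degrees in `s`. -/
def killPoly (m : ℕ) (s : Finset ℕ) : Polynomial ℝ :=
  ∏ i ∈ s, (Polynomial.X + Polynomial.C (casimirVal m i))

theorem aeval_induction {T : Module.End ℝ (SPoly m n)}
    {C : Module.End ℝ (SPoly m n) → Prop} (one : C 1) (add : ∀ A B, C A → C B → C (A + B))
    (smul : ∀ (r : ℝ) A, C A → C (r • A)) (mul : ∀ A, C A → C (A * T)) (f : Polynomial ℝ) :
    C (Polynomial.aeval T f) := by
  have hpow : ∀ l : ℕ, C (T ^ l) := by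
    intro l
    induction l with
    | zero => simpa using one
    | succ l ih => rw [pow_succ]; exact mul _ ih
  induction f using Polynomial.induction_on' with
  | add p q hp hq => rw [map_add]; exact add _ _ hp hq
  | monomial l a =>
    rw [Polynomial.aeval_monomial, ← Algebra.smul_def]
    exact smul _ _ (hpow l)

theorem aeval_mem {T : Module.End ℝ (SPoly m n)} {U : Submodule ℝ (SPoly m n)}
    (h : ∀ u ∈ U, T u ∈ U) (f : Polynomial ℝ) {u : SPoly m n} (hu : u ∈ U) :
    Polynomial.aeval T f u ∈ U := by
  refine aeval_induction (T := T) (C := fun A => ∀ u ∈ U, A u ∈ U) (fun u hu => hu)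
    (fun A B hA hB u hu => U.add_mem (hA u hu) (hB u hu))
    (fun r A hA u hu => U.smul_mem r (hA u hu)) (fun A hA u hu => hA _ (h u hu)) f u hu

theorem aeval_mul_left {T : Module.End ℝ (SPoly m n)} {x : SPoly m n}
    (h : ∀ p, T (x * p) = x * T p) (f : Polynomial ℝ) (p : SPoly m n) :
    Polynomial.aeval T f (x * p) = x * Polynomial.aeval T f p := by
  refine aeval_induction (T := T) (C := fun A => ∀ p, A (x * p) = x * A p) (fun _ => rfl)
    (fun A B hA hB p => ?_) (fun r A hA p => ?_) (fun A hA p => ?_) f p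
  · rw [LinearMap.add_apply, hA, hB, LinearMap.add_apply, mul_add]
  · rw [LinearMap.smul_apply, hA, LinearMap.smul_apply, mul_smul_comm]
  · rw [Module.End.mul_apply, h, hA, Module.End.mul_apply]

theorem aeval_eigen {T : Module.End ℝ (SPoly m n)} {p : SPoly m n} {μ : ℝ} (h : T p = μ • p)
    (f : Polynomial ℝ) : Polynomial.aeval T f p = f.eval μ • p := by
  by_cases hp : p = 0
  · simp [hp]
  · exact Module.End.aeval_apply_of_hasEigenvector
      ⟨Module.End.mem_eigenspace_iff.mpr h, hp⟩

theorem form_casimir (p q : SPoly m n) :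
    form m n (casimir m n p) q = form m n p (casimir m n q) := by
  simp only [casimir_apply, map_sum, LinearMap.sum_apply, form_Lop, eps, bar]
  rw [Finset.sum_comm]
  simp

theorem form_aeval_casimir (f : Polynomial ℝ) (p q : SPoly m n) :
    form m n (Polynomial.aeval (casimir m n) f p) q =
      form m n p (Polynomial.aeval (casimir m n) f q) := by
  -- Transposition reverses products, so commutation with the Casimir operator is carried through
  -- the induction.
  refine (aeval_induction (T := casimir m n)
    (C := fun A => (∀ p q, form m n (A p) q = form m n p (A q)) ∧
      A * casimir m n = casimir m n * A) ?_ ?_ ?_ ?_ f).1 p q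
  · exact ⟨fun _ _ => rfl, by rw [one_mul, mul_one]⟩
  · rintro A B ⟨hA, hA'⟩ ⟨hB, hB'⟩
    refine ⟨fun p q => ?_, by rw [add_mul, mul_add, hA', hB']⟩
    rw [LinearMap.add_apply, map_add, LinearMap.add_apply, hA, hB, LinearMap.add_apply, map_add]
  · rintro r A ⟨hA, hA'⟩
    refine ⟨fun p q => ?_, by rw [smul_mul_assoc, mul_smul_comm, hA']⟩
    rw [LinearMap.smul_apply, map_smul, LinearMap.smul_apply, hA, LinearMap.smul_apply, map_smul]
  · rintro A ⟨hA, hA'⟩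
    refine ⟨fun p q => ?_, by rw [← mul_assoc, ← hA']⟩
    conv_rhs => rw [hA']
    rw [Module.End.mul_apply, hA, form_casimir, Module.End.mul_apply]

theorem casimir_mem {U : Submodule ℝ (SPoly m n)} (hU : IsOspModule U) :
    ∀ u ∈ U, casimir m n u ∈ U := by
  intro u hu
  rw [isOspModule_iff] at hU
  rw [casimir_apply]
  exact Submodule.sum_mem _ fun i _ => Submodule.sum_mem _ fun j _ => hU _ _ _ (hU _ _ _ hu)

theorem Lop_evenRsq_mul (i j : Fin m) (p : SPoly m n) :
    Lop (Sum.inl i) (Sum.inl j) ((∑ i : Fin m, X (Sum.inl i) ^ 2) * p) =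
      (∑ i : Fin m, X (Sum.inl i) ^ 2) * Lop (Sum.inl i) (Sum.inl j) p := by
  have h : ∀ (l : Fin m) (p : SPoly m n), partialX (Sum.inl l)
      ((∑ i : Fin m, X (Sum.inl i) ^ 2) * p) = (∑ i : Fin m, X (Sum.inl i) ^ 2) *
        partialX (Sum.inl l) p + (2 : ℝ) • (X (Sum.inl l) * p) := by
    intro l p
    simp only [Finset.sum_mul, pow_two, mul_assoc, map_sum, partialX_X_mul, mul_add,
      Finset.sum_add_distrib]
    simp [superSign, two_smul, Finset.sum_add_distrib]
    abel
  have hx : ∀ (l : Fin m) (p : SPoly m n), X (Sum.inl l) * ((∑ i : Fin m, X (Sum.inl i) ^ 2) * p) =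
      (∑ i : Fin m, X (Sum.inl i) ^ 2) * (X (Sum.inl l) * p) := fun l p => (X_inl_mul _ _ _).symm
  rw [Lop_inl_inl_apply, Lop_inl_inl_apply, h, h]
  simp only [mul_add, mul_sub, mul_smul_comm, hx]
  rw [X_inl_mul j]
  abel

theorem casimir_evenRsq_mul (p : SPoly m n) :
    casimir m n ((∑ i : Fin m, X (Sum.inl i) ^ 2) * p) =
      (∑ i : Fin m, X (Sum.inl i) ^ 2) * casimir m n p := by
  simp only [casimir_apply, Lop_evenRsq_mul, Finset.mul_sum]

theorem casimir_of_evenEuler {d : ℕ} {p : SPoly m n} (hp : evenEuler m n p = (d : ℝ) • p) :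
    casimir m n p = (2 : ℝ) • ((∑ i : Fin m, X (Sum.inl i) ^ 2) * evenLaplacian m n p) -
      casimirVal m d • p := by
  rw [casimir_eq, hp, map_smul, hp, casimirVal]
  module

/-- In bosonic degree d, the factor for d leaves 2r²Δp. The remaining factors commute with r² and
meet Δp, of degree d - 2; for d < 2 this would be a negative Euler eigenvalue, so Δp = 0. -/
theorem aeval_killPoly {d : ℕ} {s : Finset ℕ} (hs : Finset.range (d + 1) ⊆ s) {p : SPoly m n}
    (hp : evenEuler m n p = (d : ℝ) • p) :
    Polynomial.aeval (casimir m n) (killPoly m s) p = 0 := by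
  induction d using Nat.strong_induction_on generalizing s p with
  | _ d ih =>
    have hd : d ∈ s := hs (by simp)
    have hL : evenEuler m n (evenLaplacian m n p) = ((d : ℝ) - 2) • evenLaplacian m n p := by
      rw [evenEuler_evenLaplacian, hp, map_smul]
      module
    rw [killPoly, ← Finset.prod_erase_mul _ _ hd, map_mul, Module.End.mul_apply]
    have h1 : Polynomial.aeval (casimir m n)
        (Polynomial.X + Polynomial.C (casimirVal m d)) p =
        (2 : ℝ) • ((∑ i : Fin m, X (Sum.inl i) ^ 2) * evenLaplacian m n p) := by
      rw [map_add, Polynomial.aeval_X, Polynomial.aeval_C, LinearMap.add_apply,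
        Module.algebraMap_end_apply, casimir_of_evenEuler hp, sub_add_cancel]
    rw [h1, map_smul, aeval_mul_left casimir_evenRsq_mul]
    suffices h2 : Polynomial.aeval (casimir m n) (killPoly m (s.erase d))
        (evenLaplacian m n p) = 0 by
      rw [killPoly] at h2
      rw [h2, mul_zero, smul_zero]
    rcases lt_or_ge d 2 with hd2 | hd2
    · rw [eq_zero_of_evenEuler_neg (μ := (d : ℝ) - 2) (by
        have : (d : ℝ) < 2 := by exact_mod_cast hd2
        linarith) hL, map_zero]
    · refine ih (d - 2) (by omega) (fun i hi => ?_) ?_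
      · rw [Finset.mem_range] at hi
        exact Finset.mem_erase.mpr ⟨by omega, hs (by rw [Finset.mem_range]; omega)⟩
      · rw [hL, Nat.cast_sub hd2, Nat.cast_ofNat]

theorem euler_eq (p : SPoly m n) : euler m n p = evenEuler m n p + oddEuler m n p := by
  rw [euler_apply, Fintype.sum_sum_type, evenEuler_apply, oddEuler_apply]

theorem evenEuler_of_mem_pureDeg {k : ℕ} {p : SPoly m n} (hp : p ∈ pureDeg m n k) :
    evenEuler m n p = (k : ℝ) • p := by
  obtain ⟨h1, h2⟩ := mem_pureDeg.mp hp
  rw [mem_polyDeg, euler_eq, oddEuler_apply] at h1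
  simpa [h2] using h1

/-- A monomial of degree k containing some θ has fewer than k bosonic factors. -/
theorem polyDeg_le_pureDeg_sup (k : ℕ) : polyDeg m n k ≤ pureDeg m n k ⊔
    ⨆ d : Fin k, Module.End.eigenspace (evenEuler m n) ((d : ℕ) : ℝ) := by
  rw [← linSpan_pow_eq]
  induction k with
  | zero =>
    rw [linSpan_pow_eq]
    intro p hp
    exact Submodule.mem_sup_left
      (mem_pureDeg.mpr ⟨hp, fun a => partialX_of_mem_polyDeg_zero _ hp⟩)
  | succ k ih =>
    intro p hp
    rw [linSpan_pow_succ] at hp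
    refine span_mul_induction (C := fun p => p ∈ pureDeg m n (k + 1) ⊔
      ⨆ d : Fin (k + 1), Module.End.eigenspace (evenEuler m n) ((d : ℕ) : ℝ))
      (Submodule.zero_mem _) (fun _ _ => Submodule.add_mem _) (fun i q hq => ?_) hp
    obtain ⟨q₁, h1, q₂, h2, rfl⟩ := Submodule.mem_sup.mp (ih hq)
    clear hq hp
    rw [mul_add]
    refine Submodule.add_mem _ ?_ (Submodule.mem_sup_right ?_)
    · rcases i with i | a
      · refine Submodule.mem_sup_left (mem_pureDeg.mpr
          ⟨X_mul_mem_polyDeg _ (mem_pureDeg.mp h1).1, fun a => ?_⟩)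
        rw [partialX_X_mul, (mem_pureDeg.mp h1).2]
        simp
      · refine Submodule.mem_sup_right (Submodule.mem_iSup_of_mem (Fin.last k) ?_)
        rw [Module.End.mem_eigenspace_iff, evenEuler_X_inr_mul, evenEuler_of_mem_pureDeg h1,
          mul_smul_comm, Fin.val_last]
    · induction h2 using Submodule.iSup_induction' with
      | mem d x hx =>
        rw [Module.End.mem_eigenspace_iff] at hx
        rcases i with i | a
        · refine Submodule.mem_iSup_of_mem d.succ ?_
          rw [Module.End.mem_eigenspace_iff, evenEuler_X_inl_mul, hx, mul_smul_comm, Fin.val_succ]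
          push_cast
          module
        · refine Submodule.mem_iSup_of_mem d.castSucc ?_
          rw [Module.End.mem_eigenspace_iff, evenEuler_X_inr_mul, hx, mul_smul_comm,
            Fin.val_castSucc]
      | zero => simp
      | add x y _ _ hx hy => rw [mul_add]; exact Submodule.add_mem _ hx hy

theorem casimir_mem_pureDeg {k : ℕ} {p : SPoly m n} (hp : p ∈ pureDeg m n k) :
    casimir m n p ∈ pureDeg m n k := by
  have h : ∀ i j : Fin m, ∀ p ∈ pureDeg m n k, Lop (Sum.inl i) (Sum.inl j) p ∈ pureDeg m n k := by
    intro i j p hp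
    rw [mem_pureDeg] at hp ⊢
    refine ⟨Lop_mem_polyDeg _ _ hp.1, fun a => ?_⟩
    rw [Lop_inl_inl_apply, map_sub, partialX_X_mul, partialX_X_mul, partialX_comm,
      partialX_comm (Sum.inr a) (Sum.inl i), hp.2]
    simp
  rw [casimir_apply]
  exact Submodule.sum_mem _ fun i _ => Submodule.sum_mem _ fun j _ => h _ _ _ (h _ _ _ hp)

theorem aeval_killPoly_mem_pureDeg {k : ℕ} {p : SPoly m n} (hp : p ∈ polyDeg m n k) :
    Polynomial.aeval (casimir m n) (killPoly m (Finset.range k)) p ∈ pureDeg m n k := by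
  obtain ⟨q₁, h1, q₂, h2, rfl⟩ := Submodule.mem_sup.mp (polyDeg_le_pureDeg_sup k hp)
  clear hp
  rw [map_add]
  refine Submodule.add_mem _ (aeval_mem (fun u hu => casimir_mem_pureDeg hu) _ h1) ?_
  induction h2 using Submodule.iSup_induction' with
  | mem d x hx =>
    rw [aeval_killPoly (d := d) _ (Module.End.mem_eigenspace_iff.mp hx)]
    · exact Submodule.zero_mem _
    · exact Finset.range_subset_range.mpr d.2
  | zero => simp
  | add x y _ _ hx hy => rw [map_add]; exact Submodule.add_mem _ hx hy

theorem aeval_killPoly_polyDeg {k : ℕ} {p : SPoly m n} (hp : p ∈ polyDeg m n k) :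
    Polynomial.aeval (casimir m n) (killPoly m (Finset.range (k + 1))) p = 0 := by
  obtain ⟨q₁, h1, q₂, h2, rfl⟩ := Submodule.mem_sup.mp (polyDeg_le_pureDeg_sup k hp)
  clear hp
  rw [map_add, aeval_killPoly (Finset.Subset.refl _) (evenEuler_of_mem_pureDeg h1), zero_add]
  induction h2 using Submodule.iSup_induction' with
  | mem d x hx =>
    refine aeval_killPoly (d := d) ?_ (Module.End.mem_eigenspace_iff.mp hx)
    exact Finset.range_subset_range.mpr (by omega)
  | zero => simp
  | add x y _ _ hx hy => rw [map_add, hx, hy, add_zero]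

/-- Here t is an eigenvector with eigenvalue minus the degree-k value, and no degree i < j ≤ k
shares that value. -/
theorem aeval_killPoly_harmonics (hm : 2 ≤ m) {k j : ℕ} (hjk : j ≤ k) {t : SPoly m n}
    (h1 : t ∈ harmonics m n k) (h2 : t ∈ pureDeg m n k) :
    ∃ c : ℝ, c ≠ 0 ∧
      Polynomial.aeval (casimir m n) (killPoly m (Finset.range j)) t = c • t := by
  have hL : evenLaplacian m n t = 0 := by
    have h3 := (mem_harmonics.mp h1).2
    rw [laplacian_apply] at h3
    rw [evenLaplacian_apply]
    simpa [(mem_pureDeg.mp h2).2] using h3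
  have hC : casimir m n t = (-casimirVal m k) • t := by
    rw [casimir_of_evenEuler (evenEuler_of_mem_pureDeg h2), hL, mul_zero, smul_zero, zero_sub]
    exact (neg_smul _ _).symm
  refine ⟨_, ?_, aeval_eigen hC _⟩
  rw [killPoly, Polynomial.eval_prod, Finset.prod_ne_zero_iff]
  intro i hi
  have := casimirVal_lt hm ((Finset.mem_range.mp hi).trans_le hjk)
  simp only [Polynomial.eval_add, Polynomial.eval_X, Polynomial.eval_C]
  linarith

/-! ### Fischer decomposition and irreducibility in low degree -/

/-- Applying ∇² gives the same equation for ∇²g, of degree l - 2, with c replaced by c + 4(l-2) +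
2M. The bound 8 makes this shift nonpositive, so the constant stays negative. -/
theorem eq_zero_of_Rsq_laplacian_add {l : ℕ} {c : ℝ} (hc : c < 0)
    (hl : 4 * (l : ℝ) + 2 * (superdim m n : ℝ) ≤ 8) {g : SPoly m n} (hg : g ∈ polyDeg m n l)
    (h : Rsq m n * laplacian m n g + c • g = 0) : g = 0 := by
  suffices hL : laplacian m n g = 0 by
    rw [hL, mul_zero, zero_add] at h
    exact (smul_eq_zero.mp h).resolve_left hc.ne
  induction l using Nat.strong_induction_on generalizing c g with
  | _ l ih =>
    rcases lt_or_ge l 2 with hl2 | hl2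
    · exact laplacian_of_lt_two hl2 hg
    obtain ⟨l, rfl⟩ := Nat.exists_eq_add_of_le' hl2
    have hg' := laplacian_mem_polyDeg hg
    have h1 := congrArg (laplacian m n) h
    rw [map_add, map_smul, laplacian_Rsq_mul, mem_polyDeg.mp hg', map_zero] at h1
    push_cast at hl
    have hc' : 4 * (l : ℝ) + 2 * (superdim m n : ℝ) + c < 0 := by linarith
    have h2 : Rsq m n * laplacian m n (laplacian m n g) +
        (4 * (l : ℝ) + 2 * (superdim m n : ℝ) + c) • laplacian m n g = 0 := by
      rw [← h1]
      module
    have h3 := ih l (by omega) hc' (by linarith) hg' h2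
    rw [h3, mul_zero, zero_add] at h2
    exact (smul_eq_zero.mp h2).resolve_left hc'.ne

theorem surjective_of_ker {V : Type*} [AddCommGroup V] [Module ℝ V]
    [FiniteDimensional ℝ V] (T : V →ₗ[ℝ] V) (hT : ∀ v, T v = 0 → v = 0) :
    Function.Surjective T :=
  LinearMap.injective_iff_surjective.mp ((injective_iff_map_eq_zero T).mpr hT)

/-- The operator ∇²R² is injective, hence surjective, in degree j - 2, so R²g can be chosen with the
same Laplacian as p. -/
theorem exists_harmonic_add_Rsq_mul {j : ℕ} (hj : 2 * (j : ℝ) + (superdim m n : ℝ) ≤ 0)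
    {p : SPoly m n} (hp : p ∈ polyDeg m n j) : ∃ h ∈ harmonics m n j, ∃ g, p = h + Rsq m n * g := by
  rcases lt_or_ge j 2 with hj2 | hj2
  · exact ⟨p, mem_harmonics.mpr ⟨hp, laplacian_of_lt_two hj2 hp⟩, 0, by simp⟩
  obtain ⟨l, rfl⟩ := Nat.exists_eq_add_of_le' hj2
  push_cast at hj
  have hmaps : ∀ g ∈ polyDeg m n l,
      (laplacian m n * LinearMap.mulLeft ℝ (Rsq m n)) g ∈ polyDeg m n l :=
    fun g hg => laplacian_mem_polyDeg (Rsq_mul_mem_polyDeg hg)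
  obtain ⟨⟨g, hg⟩, hg'⟩ := surjective_of_ker (V := polyDeg m n l)
    ((laplacian m n * LinearMap.mulLeft ℝ (Rsq m n)).restrict hmaps) (by
      rintro ⟨g, hg⟩ h
      ext1
      have h1 : laplacian m n (Rsq m n * g) = 0 := congrArg Subtype.val h
      rw [laplacian_Rsq_mul, mem_polyDeg.mp hg] at h1
      refine eq_zero_of_Rsq_laplacian_add (c := 4 * (l : ℝ) + 2 * (superdim m n : ℝ))
        (by linarith) (by linarith) hg ?_
      rw [← h1]
      module) ⟨laplacian m n p, laplacian_mem_polyDeg hp⟩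
  have hg2 : laplacian m n (Rsq m n * g) = laplacian m n p := congrArg Subtype.val hg'
  refine ⟨p - Rsq m n * g, mem_harmonics.mpr
    ⟨Submodule.sub_mem _ hp (Rsq_mul_mem_polyDeg hg), ?_⟩, g, by abel⟩
  rw [map_sub, hg2, sub_self]

theorem exists_pureDeg_mem (hm : 2 ≤ m) {j : ℕ} (hj : 2 * (j : ℝ) + (superdim m n : ℝ) ≤ 0)
    {U : Submodule ℝ (SPoly m n)} (hU : IsOspModule U) (hUj : U ≤ harmonics m n j) (h0 : U ≠ ⊥) :
    ∃ t ∈ U, t ∈ pureDeg m n j ∧ t ≠ 0 := by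
  -- Otherwise U consists of harmonic multiples of R², which are orthogonal both to harmonics and to
  -- multiples of R², hence to everything of degree j.
  have hnot : ¬ U ≤ rsqIdeal m n ⊔ thetaFilt m n 1 := by
    intro h
    apply h0
    rw [eq_bot_iff]
    intro f hf
    obtain ⟨hf1, hf2⟩ := mem_harmonics.mp (hUj hf)
    refine eq_zero_of_form_eq_zero hf1 fun p hp => ?_
    obtain ⟨q, hq, g, rfl⟩ := exists_harmonic_add_Rsq_mul hj hp
    obtain ⟨g', rfl⟩ := le_rsqIdeal_of_isOspModule hm hU h hf
    rw [map_add, LinearMap.add_apply, form_Rsq_mul, hf2, map_zero, add_zero, form_symm,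
      LinearMap.mulLeft_apply, form_Rsq_mul, (mem_harmonics.mp hq).2, map_zero]
  obtain ⟨u, hu, hu'⟩ := SetLike.not_le_iff_exists.mp hnot
  have hud := (mem_harmonics.mp (hUj hu)).1
  obtain ⟨t, ht, ht', hne⟩ := exists_form_ne_zero hud hu'
  obtain ⟨h1, h2⟩ := mem_harmonics_inf_pureDeg ht ht'
  obtain ⟨c, hc, hct⟩ := aeval_killPoly_harmonics hm le_rfl h1 h2
  -- The Casimir polynomial projects u to a θ-free element of U. It is self-adjoint and scales t by
  -- c ≠ 0, so the pairing with t stays nonzero.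
  refine ⟨_, aeval_mem (casimir_mem hU) (killPoly m (Finset.range j)) hu,
    aeval_killPoly_mem_pureDeg hud, fun h => ?_⟩
  have h3 := form_aeval_casimir (killPoly m (Finset.range j)) u t
  rw [h, hct, map_zero, LinearMap.zero_apply, map_smul, smul_eq_mul] at h3
  exact mul_ne_zero hc hne h3.symm

/-- The product of the first `r` odd coordinates `θ_{(0,0)}, θ_{(1,0)}, …`. -/
def oddTop (m n : ℕ) : ℕ → SPoly m n
  | 0 => 1
  | r + 1 => if h : r < n then X (Sum.inr (⟨r, h⟩, 0)) * oddTop m n r else 0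

theorem oddTop_succ {r : ℕ} (h : r < n) :
    oddTop m n (r + 1) = X (Sum.inr (⟨r, h⟩, 0)) * oddTop m n r := by
  simp [oddTop, h]

theorem partialX_oddTop_mul {r : ℕ} (hr : r ≤ n) {a : Fin n × Fin 2}
    (ha : a.2 = 1 ∨ r ≤ (a.1 : ℕ)) {t : SPoly m n} (ht : partialX (Sum.inr a) t = 0) :
    partialX (Sum.inr a) (oddTop m n r * t) = 0 := by
  induction r with
  | zero => simpa [oddTop] using ht
  | succ r ih =>
    have hne : (Sum.inr a : Idx m n) ≠ Sum.inr (⟨r, hr⟩, 0) := by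
      intro h
      rw [Sum.inr.injEq] at h
      subst h
      simp at ha
    rw [oddTop_succ hr, mul_assoc, partialX_X_mul, if_neg hne, ih (by omega) (by omega)]
    simp

theorem partialX_inl_oddTop_mul {r : ℕ} (hr : r ≤ n) (i : Fin m) (t : SPoly m n) :
    partialX (Sum.inl i) (oddTop m n r * t) = oddTop m n r * partialX (Sum.inl i) t := by
  induction r with
  | zero => simp [oddTop]
  | succ r ih =>
    rw [oddTop_succ hr, mul_assoc, partialX_X_mul, ih (by omega), mul_assoc]
    simp [superSign]

theorem partialX_oddTop {r : ℕ} (hr : r ≤ n) {a : Fin n × Fin 2}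
    (ha : a.2 = 1 ∨ r ≤ (a.1 : ℕ)) : partialX (Sum.inr a) (oddTop m n r) = 0 := by
  simpa using partialX_oddTop_mul (m := m) hr ha (t := 1) (by simp)

/-- The form pairs each θ with itself, not with its symplectic partner. -/
theorem form_oddTop_ne_zero {r : ℕ} (hr : r ≤ n) :
    form m n (oddTop m n r) (oddTop m n r) ≠ 0 := by
  induction r with
  | zero => simp [oddTop, form_one_one]
  | succ r ih =>
    rw [oddTop_succ hr, form_X_mul, partialX_X_mul, if_pos rfl,
      partialX_oddTop (by omega) (Or.inr le_rfl), mul_zero, smul_zero, add_zero]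
    exact mul_ne_zero (metricCoeff_ne_zero _) (ih (by omega))

theorem oddTop_mem_harmonics {r : ℕ} (hr : r ≤ n) : oddTop m n r ∈ harmonics m n r := by
  rw [mem_harmonics]
  constructor
  · induction r with
    | zero => exact mem_polyDeg_zero.mpr ⟨1, by simp [oddTop]⟩
    | succ r ih => rw [oddTop_succ hr]; exact X_mul_mem_polyDeg _ (ih (by omega))
  · have h1 : ∀ i : Fin m, partialX (Sum.inl i) (oddTop m n r) = 0 := by
      intro i
      simpa using partialX_inl_oddTop_mul hr i (1 : SPoly m n)
    have h2 : ∀ j : Fin n, partialX (Sum.inr (j, 1)) (oddTop m n r) = 0 := fun j =>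
      partialX_oddTop hr (Or.inl rfl)
    simp [laplacian_apply, h1, h2]

theorem exists_partialX_inl_ne_zero {d : ℕ} {t : SPoly m n} (ht : t ∈ pureDeg m n (d + 1))
    (h0 : t ≠ 0) : ∃ i : Fin m, partialX (Sum.inl i) t ∈ pureDeg m n d ∧
      partialX (Sum.inl i) t ≠ 0 := by
  obtain ⟨h1, h2⟩ := mem_pureDeg.mp ht
  by_contra! hcon
  have hmem : ∀ i : Fin m, partialX (Sum.inl i) t ∈ pureDeg m n d := by
    intro i
    rw [mem_pureDeg]
    refine ⟨partialX_mem_polyDeg _ h1, fun a => ?_⟩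
    rw [partialX_comm, h2, map_zero, smul_zero]
  refine h0 (eq_zero_of_partialX_eq_zero h1 ?_)
  rintro (i | a)
  · exact hcon i (hmem i)
  · exact h2 a

/-- The rotation mixing θ_{(r,0)} and x_i acts as θ_{(r,0)} ∂_{x_i} here, because the other term
differentiates in θ_{(r,1)}, which does not occur. Each step trades one bosonic degree for a new odd
variable until t is constant; this takes j ≤ n odd pairs. -/
theorem oddTop_mem {j : ℕ} (hjn : j ≤ n) {U : Submodule ℝ (SPoly m n)} (hU : IsOspModule U)
    {t : SPoly m n} (htU : t ∈ U) (ht : t ∈ pureDeg m n j) (h0 : t ≠ 0) : oddTop m n j ∈ U := by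
  rw [isOspModule_iff] at hU
  have key : ∀ r d, r + d = j → ∃ t ∈ pureDeg m n d, t ≠ 0 ∧ oddTop m n r * t ∈ U := by
    intro r
    induction r with
    | zero =>
      rintro d hd
      obtain rfl : d = j := by omega
      exact ⟨t, ht, h0, by simpa [oddTop] using htU⟩
    | succ r ih =>
      intro d hd
      have hr : r < n := by omega
      obtain ⟨t, ht, h0, htU⟩ := ih (d + 1) (by omega)
      obtain ⟨i, hi, hne⟩ := exists_partialX_inl_ne_zero ht h0
      refine ⟨_, hi, hne, ?_⟩
      have h1 := hU (Sum.inr (⟨r, hr⟩, 0)) (Sum.inl i) _ htU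
      have h2 : partialUp (Sum.inr (⟨r, hr⟩, 0)) (oddTop m n r * t) = 0 := by
        rw [partialUp_eq, LinearMap.smul_apply, bar,
          partialX_oddTop_mul hr.le (Or.inl (by simp)) ((mem_pureDeg.mp ht).2 _), smul_zero]
      have h3 : partialUp (Sum.inl i : Idx m n) = partialX (Sum.inl i) := rfl
      rw [Lop_apply, h2, h3, mul_zero, smul_zero, sub_zero, partialX_inl_oddTop_mul hr.le,
        ← mul_assoc, ← oddTop_succ hr] at h1
      exact h1
  obtain ⟨t, ht, h0, htU⟩ := key j 0 rfl
  obtain ⟨c, rfl⟩ := mem_polyDeg_zero.mp (mem_pureDeg.mp ht).1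
  rw [mul_smul_comm, mul_one] at htU
  refine (Submodule.smul_mem_iff _ fun hc => h0 ?_).mp htU
  rw [hc, zero_smul]

/-- Below the critical degree the harmonics form an irreducible module. -/
theorem eq_harmonics_of_isOspModule (hm : 2 ≤ m) {j : ℕ} (hjn : j ≤ n)
    (hj : 2 * (j : ℝ) + (superdim m n : ℝ) ≤ 0) {U : Submodule ℝ (SPoly m n)}
    (hU : IsOspModule U) (hUj : U ≤ harmonics m n j) (h0 : U ≠ ⊥) : U = harmonics m n j := by
  refine le_antisymm hUj fun f hf => ?_
  by_contra hfU
  obtain ⟨hf1, hf2⟩ := mem_harmonics.mp hf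
  obtain ⟨q, hq, hqU, hne⟩ := exists_form_ne_zero hf1 hfU
  obtain ⟨q', hq', g, rfl⟩ := exists_harmonic_add_Rsq_mul hj hq
  have horth : ∀ p ∈ harmonics m n j, form m n p (Rsq m n * g) = 0 := by
    intro p hp
    rw [form_symm, form_Rsq_mul, (mem_harmonics.mp hp).2, map_zero]
  rw [map_add, horth f hf, add_zero] at hne
  have hU' : IsOspModule (formPerp U j ⊓ harmonics m n j) := fun A hA v hv =>
    ⟨isOspModule_formPerp hU j A hA v hv.1, isOspModule_harmonics j A hA v hv.2⟩
  -- Removing the multiple of R² from q does not change its pairings with harmonics.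
  have hqmem : q' ∈ formPerp U j ⊓ harmonics m n j := by
    refine ⟨⟨(mem_harmonics.mp hq').1, fun v hv hv' => ?_⟩, hq'⟩
    have := hqU v hv hv'
    rwa [map_add, horth v (hUj hv), add_zero] at this
  have hU'0 : formPerp U j ⊓ harmonics m n j ≠ ⊥ := by
    intro h
    rw [h, Submodule.mem_bot] at hqmem
    rw [hqmem, map_zero] at hne
    exact hne rfl
  obtain ⟨t, htU, ht, ht0⟩ := exists_pureDeg_mem hm hj hU hUj h0
  obtain ⟨t', htU', ht', ht0'⟩ := exists_pureDeg_mem hm hj hU' inf_le_right hU'0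
  have h1 := oddTop_mem hjn hU htU ht ht0
  have h2 := oddTop_mem hjn hU' htU' ht' ht0'
  exact form_oddTop_ne_zero hjn (h2.1.2 _ h1 (mem_harmonics.mp (hUj h1)).1)

/-! ### Multiplication by powers of R² -/

theorem sum_sq_ne_zero (hm : 1 ≤ m) :
    (∑ i : Fin m, MvPolynomial.X i ^ 2 : MvPolynomial (Fin m) ℝ) ≠ 0 := by
  intro h
  have := congrArg (MvPolynomial.eval (Pi.single (⟨0, hm⟩ : Fin m) (1 : ℝ))) h
  simp [Pi.single_apply] at this

theorem eq_zero_of_tmul_one_mul {q : MvPolynomial (Fin m) ℝ} (hq : q ≠ 0) {p : SPoly m n}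
    (h : q ⊗ₜ[ℝ] 1 * p = 0) : p = 0 := by
  have hinj : Function.Injective (LinearMap.mulLeft ℝ q) := fun a b hab =>
    mul_left_cancel₀ hq hab
  have h2 := Module.Flat.rTensor_preserves_injective_linearMap
    (M := ExteriorAlgebra ℝ (Fin n × Fin 2 → ℝ)) (LinearMap.mulLeft ℝ q) hinj
  have h3 : ∀ p : SPoly m n, LinearMap.rTensor (ExteriorAlgebra ℝ (Fin n × Fin 2 → ℝ))
      (LinearMap.mulLeft ℝ q) p = q ⊗ₜ[ℝ] 1 * p := by
    intro p
    induction p using TensorProduct.induction_on with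
    | zero => simp
    | add x y hx hy => rw [map_add, hx, hy, mul_add]
    | tmul a b => simp
  apply h2
  rw [h3, h, map_zero]

theorem X_mul_tmul_one_mul (i : Idx m n) (q : MvPolynomial (Fin m) ℝ) (p : SPoly m n) :
    X i * (q ⊗ₜ[ℝ] 1 * p) = q ⊗ₜ[ℝ] 1 * (X i * p) := by
  rw [← mul_assoc, ← mul_assoc]
  congr 1
  rcases i with i | a <;> simp [X, mul_comm]

/-- With r² = ∑ x_i², the hypothesis lets r² act on p as the nilpotent ∑ θ_{(j,0)} θ_{(j,1)}. So a
power of r² kills p, while r² itself is a nonzero bosonic polynomial and acts injectively. -/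
theorem eq_zero_of_Rsq_mul (hm : 1 ≤ m) {p : SPoly m n} (h : Rsq m n * p = 0) : p = 0 := by
  let q : MvPolynomial (Fin m) ℝ := ∑ i : Fin m, MvPolynomial.X i ^ 2
  have hq : q ⊗ₜ[ℝ] 1 * p = ∑ j : Fin n, X (Sum.inr (j, 0)) * (X (Sum.inr (j, 1)) * p) := by
    have h1 : q ⊗ₜ[ℝ] 1 * p = ∑ i : Fin m, X (Sum.inl i) * (X (Sum.inl i) * p) := by
      simp [q, X, TensorProduct.sum_tmul, Finset.sum_mul, ← mul_assoc, pow_two]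
    rw [Rsq_mul, sub_eq_zero] at h
    rw [h1, h]
  have key : ∀ t : ℕ, (q ^ t) ⊗ₜ[ℝ] 1 * p ∈ thetaFilt m n t := by
    intro t
    induction t with
    | zero => trivial
    | succ t ih =>
      have h1 : (q ^ (t + 1)) ⊗ₜ[ℝ] 1 * p = (q ^ t) ⊗ₜ[ℝ] 1 * (q ⊗ₜ[ℝ] 1 * p) := by
        rw [← mul_assoc, Algebra.TensorProduct.tmul_mul_tmul, one_mul, pow_succ]
      rw [h1, hq, Finset.mul_sum]
      refine Submodule.sum_mem _ fun j _ => ?_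
      rw [← X_mul_tmul_one_mul, ← X_mul_tmul_one_mul]
      exact thetaFilt_antitone (Nat.le_succ _)
        (X_inr_mul_mem_thetaFilt _ (X_inr_mul_mem_thetaFilt _ ih))
  have h2 := key (2 * n + 1)
  rw [thetaFilt_eq_bot, Submodule.mem_bot] at h2
  exact eq_zero_of_tmul_one_mul (pow_ne_zero _ (sum_sq_ne_zero hm)) h2

theorem Lop_Rsq_pow_mul (s : ℕ) (i j : Idx m n) (p : SPoly m n) :
    Lop i j (Rsq m n ^ s * p) = Rsq m n ^ s * Lop i j p := by
  induction s with
  | zero => simp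
  | succ s ih => rw [pow_succ', mul_assoc, Lop_Rsq_mul, ih, mul_assoc]

theorem casimir_Rsq_pow_mul (s : ℕ) (p : SPoly m n) :
    casimir m n (Rsq m n ^ s * p) = Rsq m n ^ s * casimir m n p := by
  simp only [casimir_apply, Lop_Rsq_pow_mul, Finset.mul_sum]

theorem Rsq_pow_mul_mem_polyDeg (s : ℕ) {k : ℕ} {p : SPoly m n} (hp : p ∈ polyDeg m n k) :
    Rsq m n ^ s * p ∈ polyDeg m n (k + 2 * s) := by
  induction s with
  | zero => simpa using hp
  | succ s ih => rw [pow_succ', mul_assoc]; exact Rsq_mul_mem_polyDeg ih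

theorem laplacian_Rsq_pow_mul (s : ℕ) {k : ℕ} {p : SPoly m n} (hp : p ∈ harmonics m n k) :
    laplacian m n (Rsq m n ^ (s + 1) * p) =
      (2 * ((s : ℝ) + 1) * (2 * k + 2 * s + (superdim m n : ℝ))) • (Rsq m n ^ s * p) := by
  obtain ⟨h1, h2⟩ := mem_harmonics.mp hp
  induction s with
  | zero =>
    rw [zero_add, pow_one, laplacian_Rsq_mul, h2, mem_polyDeg.mp h1, pow_zero, one_mul]
    simp
    module
  | succ s ih =>
    rw [pow_succ', mul_assoc, laplacian_Rsq_mul, ih,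
      mem_polyDeg.mp (Rsq_pow_mul_mem_polyDeg (s + 1) h1), mul_smul_comm, ← mul_assoc, ← pow_succ']
    push_cast
    module

theorem isOspModule_RpowHarmonics (s j : ℕ) : IsOspModule (RpowHarmonics m n s j) := by
  have h := isOspModule_harmonics (m := m) (n := n) j
  rw [isOspModule_iff] at h ⊢
  rintro a b _ ⟨p, hp, rfl⟩
  exact ⟨_, h a b p hp, (Lop_Rsq_pow_mul s a b p).symm⟩

theorem RpowHarmonics_ne_bot (hm : 1 ≤ m) (s : ℕ) {j : ℕ} (hjn : j ≤ n) :
    RpowHarmonics m n s j ≠ ⊥ := by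
  intro h
  have h1 : Rsq m n ^ s * oddTop m n j = 0 := by
    rw [← Submodule.mem_bot ℝ, ← h]
    exact ⟨_, oddTop_mem_harmonics hjn, rfl⟩
  have h2 : oddTop m n j = 0 := by
    clear h
    induction s with
    | zero => simpa using h1
    | succ s ih => rw [pow_succ', mul_assoc] at h1; exact ih (eq_zero_of_Rsq_mul hm h1)
  have := form_oddTop_ne_zero (m := m) hjn
  rw [h2, map_zero] at this
  exact this rfl

theorem isOspIrreducible_RpowHarmonics (hm : 2 ≤ m) (s : ℕ) {j : ℕ} (hjn : j ≤ n)
    (hj : 2 * (j : ℝ) + (superdim m n : ℝ) ≤ 0) : IsOspIrreducible (RpowHarmonics m n s j) := by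
  refine ⟨isOspModule_RpowHarmonics s j, RpowHarmonics_ne_bot (by omega) s hjn, fun U hUW hU => ?_⟩
  have hU' : IsOspModule (harmonics m n j ⊓ U.comap (LinearMap.mulLeft ℝ (Rsq m n ^ s))) := by
    have h := isOspModule_harmonics (m := m) (n := n) j
    rw [isOspModule_iff] at h hU ⊢
    rintro a b v ⟨hv1, hv2⟩
    refine ⟨h a b v hv1, ?_⟩
    change Rsq m n ^ s * Lop a b v ∈ U
    rw [← Lop_Rsq_pow_mul]
    exact hU a b _ hv2
  by_cases h0 : harmonics m n j ⊓ U.comap (LinearMap.mulLeft ℝ (Rsq m n ^ s)) = ⊥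
  · left
    rw [eq_bot_iff]
    intro u hu
    obtain ⟨p, hp, rfl⟩ := hUW hu
    have : p ∈ harmonics m n j ⊓ U.comap (LinearMap.mulLeft ℝ (Rsq m n ^ s)) := ⟨hp, hu⟩
    rw [h0, Submodule.mem_bot] at this
    simp [this]
  · right
    have h := eq_harmonics_of_isOspModule hm hjn hj hU' inf_le_left h0
    refine le_antisymm hUW ?_
    rintro _ ⟨p, hp, rfl⟩
    rw [← h] at hp
    exact hp.2

/-! ### Absence of an invariant complement -/

theorem not_hasOspComplement (hm : 2 ≤ m) (s : ℕ) {j k : ℕ} (hjn : j ≤ n) (hjk : j < k)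
    (hle : RpowHarmonics m n s j ≤ harmonics m n k) :
    ¬ HasOspComplement (RpowHarmonics m n s j) (harmonics m n k) := by
  rintro ⟨U, hU, hdis, hsup⟩
  refine RpowHarmonics_ne_bot (by omega) s hjn (disjoint_self.mp (hdis.mono_right (hle.trans ?_)))
  refine harmonics_le_of_pureDeg_le hm hU fun t ht ht' => ?_
  obtain ⟨w, hw, u, hu, rfl⟩ := Submodule.mem_sup.mp (hsup ▸ ht : t ∈ _)
  -- The range has to include j, so that the Casimir polynomial kills all of degree j; it is still
  -- nonzero on t because j + 1 ≤ k.
  obtain ⟨c, hc, hct⟩ := aeval_killPoly_harmonics hm (Nat.succ_le_of_lt hjk) ht ht'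
  obtain ⟨p, hp, rfl⟩ := hw
  rw [map_add, LinearMap.mulLeft_apply, aeval_mul_left (casimir_Rsq_pow_mul s),
    aeval_killPoly_polyDeg (mem_harmonics.mp hp).1, mul_zero, zero_add] at hct
  rw [← Submodule.smul_mem_iff _ hc, LinearMap.mulLeft_apply, ← hct]
  exact aeval_mem (casimir_mem hU) _ hu

/-! ### Complete reducibility gives invariant complements -/

section OperatorModules

variable {E : Type*} [AddCommGroup E] [Module ℝ E] {O : Set (Module.End ℝ E)}

/-- A subspace stable under a set of operators, as a submodule over the algebra they generate. -/
def toAdjoin (V : Submodule ℝ E) (hV : ∀ A ∈ O, ∀ v ∈ V, A v ∈ V) :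
    Submodule (Algebra.adjoin ℝ O) E where
  carrier := V
  zero_mem' := V.zero_mem
  add_mem' := V.add_mem
  smul_mem' := by
    rintro ⟨A, hA⟩ v hv
    change A v ∈ V
    induction hA using Algebra.adjoin_induction generalizing v with
    | mem A hA => exact hV A hA v hv
    | algebraMap r => exact V.smul_mem r hv
    | add A B _ _ hA hB => exact V.add_mem (hA hv) (hB hv)
    | mul A B _ _ hA hB => exact hA (hB hv)

theorem restrictScalars_adjoin_stable (Q : Submodule (Algebra.adjoin ℝ O) E) :
    ∀ A ∈ O, ∀ v ∈ Q.restrictScalars ℝ, A v ∈ Q.restrictScalars ℝ := fun A hA _ hv =>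
  Q.smul_mem (⟨A, Algebra.subset_adjoin hA⟩ : Algebra.adjoin ℝ O) hv

theorem isSimpleModule_toAdjoin {U : Submodule ℝ E} (hU : ∀ A ∈ O, ∀ v ∈ U, A v ∈ U)
    (h0 : U ≠ ⊥) (hsimple : ∀ Q ≤ U, (∀ A ∈ O, ∀ v ∈ Q, A v ∈ Q) → Q = ⊥ ∨ Q = U) :
    IsSimpleModule (Algebra.adjoin ℝ O) (toAdjoin U hU) := by
  rw [isSimpleModule_iff_isAtom]
  refine ⟨fun h => h0 ?_, fun Q hQ => ?_⟩
  · rw [eq_bot_iff]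
    intro u hu
    have : u ∈ toAdjoin U hU := hu
    rwa [h] at this
  · rcases hsimple (Q.restrictScalars ℝ) hQ.le (restrictScalars_adjoin_stable Q) with h | h
    · rw [eq_bot_iff]
      intro u hu
      have : u ∈ Q.restrictScalars ℝ := hu
      rwa [h] at this
    · refine absurd (fun u hu => ?_) hQ.not_ge
      have : u ∈ Q.restrictScalars ℝ := h ▸ hu
      exact this

/-- Over the algebra generated by O, stable subspaces are submodules and V is a sum of simple ones.
It is therefore semisimple, and every submodule has a complement. -/
theorem exists_stable_complement {S : Set (Submodule ℝ E)}
    (hS : ∀ U ∈ S, (∀ A ∈ O, ∀ v ∈ U, A v ∈ U) ∧ U ≠ ⊥ ∧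
      ∀ Q ≤ U, (∀ A ∈ O, ∀ v ∈ Q, A v ∈ Q) → Q = ⊥ ∨ Q = U)
    {V W : Submodule ℝ E} (hsup : sSup S = V) (hV : ∀ A ∈ O, ∀ v ∈ V, A v ∈ V)
    (hW : ∀ A ∈ O, ∀ v ∈ W, A v ∈ W) (hWV : W ≤ V) :
    ∃ U : Submodule ℝ E, (∀ A ∈ O, ∀ v ∈ U, A v ∈ U) ∧ Disjoint W U ∧ W ⊔ U = V := by
  have heq : toAdjoin V hV = ⨆ U : S, toAdjoin U.1 (hS U.1 U.2).1 := by
    refine le_antisymm ?_ (iSup_le fun U => (hsup ▸ le_sSup U.2 : U.1 ≤ V))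
    have hle : V ≤ (⨆ U : S, toAdjoin U.1 (hS U.1 U.2).1).restrictScalars ℝ := by
      rw [← hsup]
      exact sSup_le fun U hU => le_iSup (fun U : S => toAdjoin U.1 (hS U.1 U.2).1) ⟨U, hU⟩
    exact hle
  have hss : IsSemisimpleModule (Algebra.adjoin ℝ O)
      (toAdjoin V hV) := by
    rw [heq, ← iSup_univ]
    refine isSemisimpleModule_biSup_of_isSemisimpleModule_submodule fun U _ => ?_
    have := isSimpleModule_toAdjoin (hS U.1 U.2).1 (hS U.1 U.2).2.1 (hS U.1 U.2).2.2
    infer_instance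
  have := hss.toComplementedLattice
  obtain ⟨Q, hQ⟩ := exists_isCompl ((toAdjoin W hW).comap (toAdjoin V hV).subtype)
  refine ⟨(Q.map (toAdjoin V hV).subtype).restrictScalars ℝ, restrictScalars_adjoin_stable _, ?_, ?_⟩
  · rw [Submodule.disjoint_def]
    rintro _ hx ⟨y, hy, rfl⟩
    have := (Submodule.disjoint_def.mp hQ.disjoint) y hx hy
    rw [this, map_zero]
  · refine le_antisymm (sup_le hWV ?_) fun v hv => ?_
    · rintro _ ⟨y, _, rfl⟩
      exact y.2
    · have hv' : (⟨v, hv⟩ : toAdjoin V hV) ∈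
          (toAdjoin W hW).comap (toAdjoin V hV).subtype ⊔ Q := by
        rw [hQ.sup_eq_top]
        trivial
      obtain ⟨w, hw, u, hu, hwu⟩ := Submodule.mem_sup.mp hv'
      refine Submodule.mem_sup.mpr ⟨w, hw, u, ⟨u, hu, rfl⟩, congrArg Subtype.val hwu⟩

end OperatorModules

theorem hasOspComplement_of_completelyReducible {V W : Submodule ℝ (SPoly m n)}
    (h : IsOspCompletelyReducible V) (hV : IsOspModule V) (hW : IsOspModule W) (hWV : W ≤ V) :
    HasOspComplement W V := by
  obtain ⟨S, hS, -, hsup⟩ := h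
  exact exists_stable_complement (O := (osp m n : Set (Module.End ℝ (SPoly m n)))) hS hsup hV hW hWV

end OspHarmonic

end

/-! ### The main theorem -/

theorem mainTheorem9 (m n k : ℕ) (hm : 1 ≤ m)
    (hM : ∃ N : ℕ, OspHarmonic.superdim m n = -2 * (N : ℤ))
    (hk₁ : 2 - (OspHarmonic.superdim m n : ℝ) / 2 ≤ (k : ℝ))
    (hk₂ : (k : ℤ) ≤ 2 - OspHarmonic.superdim m n) :
    OspHarmonic.IsOspModule (OspHarmonic.harmonics m n k) ∧
    ¬ OspHarmonic.IsOspCompletelyReducible (OspHarmonic.harmonics m n k) ∧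
    ∃ s j : ℕ,
      2 * (s : ℤ) = 2 * (k : ℤ) + OspHarmonic.superdim m n - 2 ∧
      (j : ℤ) = 2 - OspHarmonic.superdim m n - (k : ℤ) ∧
      OspHarmonic.RpowHarmonics m n s j ≤ OspHarmonic.harmonics m n k ∧
      OspHarmonic.IsOspIrreducible (OspHarmonic.RpowHarmonics m n s j) ∧
      ¬ OspHarmonic.HasOspComplement
        (OspHarmonic.RpowHarmonics m n s j) (OspHarmonic.harmonics m n k) := by
  obtain ⟨N, hN⟩ := hM
  have hmn : (m : ℤ) - 2 * n = -2 * N := hN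
  have hk₁' : 2 + N ≤ k := by
    rw [hN] at hk₁
    push_cast at hk₁
    have : (2 : ℝ) + N ≤ k := by linarith
    exact_mod_cast this
  rw [hN] at hk₂
  obtain ⟨j, hj⟩ : ∃ j, j + k = 2 + 2 * N := ⟨2 + 2 * N - k, by omega⟩
  -- With M = -2N the exponent k + M/2 - 1 equals k - N - 1, which is positive and is written s + 1.
  obtain ⟨s, hs⟩ : ∃ s, s + 1 + N + 1 = k := ⟨k - N - 2, by omega⟩
  have hMR : (OspHarmonic.superdim m n : ℝ) = -2 * N := by rw [hN]; push_cast; ring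
  have hjN : j ≤ N := by omega
  -- Since m = 2(n - N) is even and positive, m ≥ 2 and N < n; the latter with j ≤ N gives j ≤ n.
  have hm2 : 2 ≤ m := by omega
  have hjn : j ≤ n := by omega
  have hdeg : 2 * (j : ℝ) + (OspHarmonic.superdim m n : ℝ) ≤ 0 := by
    have : (j : ℝ) ≤ N := by exact_mod_cast hjN
    rw [hMR]
    linarith
  have hle : OspHarmonic.RpowHarmonics m n (s + 1) j ≤ OspHarmonic.harmonics m n k := by
    rintro _ ⟨p, hp, rfl⟩
    rw [OspHarmonic.mem_harmonics, LinearMap.mulLeft_apply]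
    constructor
    · have := OspHarmonic.Rsq_pow_mul_mem_polyDeg (s + 1) (OspHarmonic.mem_harmonics.mp hp).1
      rwa [show j + 2 * (s + 1) = k by omega] at this
    -- This is the factor of `laplacian_Rsq_pow_mul` that vanishes, because j + s = N.
    · have h0 : 2 * (j : ℝ) + 2 * s + -2 * N = 0 := by
        have : j + s = N := by omega
        rw [← this]
        push_cast
        ring
      rw [OspHarmonic.laplacian_Rsq_pow_mul s hp, hMR, h0, mul_zero, zero_smul]
  have hno := OspHarmonic.not_hasOspComplement hm2 (s + 1) hjn (by omega) hle
  refine ⟨OspHarmonic.isOspModule_harmonics k, fun hred => hno ?_, s + 1, j, ?_, ?_, hle,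
    OspHarmonic.isOspIrreducible_RpowHarmonics hm2 (s + 1) hjn hdeg, hno⟩
  · exact OspHarmonic.hasOspComplement_of_completelyReducible hred
      (OspHarmonic.isOspModule_harmonics k) (OspHarmonic.isOspModule_RpowHarmonics _ _) hle
  · rw [hN]; omega
  · rw [hN]; omega
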